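/- Let $m\le n$ be natural numbers and let $$E=\{(X,Y)\in \mathrm{Mat}(m,n,\mathbb C)\times \mathrm{Mat}(n,m,\mathbb C):\ XY \text{ is lower triangular and } YX \text{ is upper triangular}\}$$ be the rectangular lower-upper scheme, i.e. the affine scheme cut out by the entries of $XY$ above the diagonal and the entries of $YX$ below the diagonal. Let $B_-$ be the group of invertible lower triangular $m\times m$ matrices and $B_+$ the group of invertible upper triangular $n\times n$ matrices; $B_-\times B_+$ acts on $E$ by $(b,c)\cdot(X,Y)=(bXc^{-1},cYb^{-1})$. Let $\mathcal S_{m,n}$ be the set of injections $\pi:\{1,\dots,m\}\to\{1,\dots,n\}$, and identify $\pi$ with the $m\times n$ matrix having $\pi_{ij}=1$ if $\pi(i)=j$ and $\pi_{ij}=0$ otherwise. For $\pi\in\mathcal S_{m,n}$ put (closures are Zariski closures) $$E_\pi:=\overline{\{(X,Y)\in E:\ (YX)_{\pi(i)\pi(i)}=(XY)_{ii}\ \text{for } i=1,\dots,m,\ \text{these } m \text{ numbers being distinct and nonzero}\}}.$$ Then: 1. The irreducible components of $E$ are exactly the $E_\pi$, $\pi\in\mathcal S_{m,n}$, and $E_\pi\ne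 E_\rho$ for $\pi\neq\rho$. They all have the top dimension $m(n+1)=\dim E$. 2. For every $\pi\in\mathcal S_{m,n}$, $$E_\pi=\overline{(B_-\times B_+)\cdot\{(\pi,\pi^Ts):\ s \text{ a diagonal } m\times m \text{ matrix}\}}.$$ 3. For a $p\times q$ matrix $w$ let $\overline X_w$ be the Zariski closure in $\mathrm{Mat}(p,q,\mathbb C)$ of the set of products $bwc$, with $b$ invertible lower triangular of size $p\times p$ and $c$ invertible upper triangular of size $q\times q$ (for $w$ a partial permutation matrix this is the matrix Schubert variety of $w$). For every $\pi\in\mathcal S_{m,n}$ the image of $E_\pi$ under $(X,Y)\mapsto X$ is $\overline X_\pi$, and the image of $E_\pi$ under $(X,Y)\mapsto Y$ is $$\gamma_n\,\overline X_{\gamma_n\pi^T\gamma_m}\,\gamma_m,$$ where $\gamma_k$ denotes the permutation matrix of the longest element $i\mapsto k+1-i$ of the symmetric group $\mathcal S_k$. -/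

import Mathlib

noncomputable section

namespace LowerUpper

open Matrix MvPolynomial AlgebraicGeometry CategoryTheory

/-! ### Affine spaces of matrices and their complex points -/

/-- The point of `Spec A` given by a ring homomorphism `f : A →+* ℂ`, that is, its kernel. -/
def specPoint {A : Type} [CommRing A] (f : A →+* ℂ) : Spec (CommRingCat.of A) :=
  (⟨RingHom.ker f, RingHom.ker_isPrime f⟩ : PrimeSpectrum A)

/-- The affine space `Mat(p, q, ℂ)` as a scheme. -/
abbrev matSpace (p q : ℕ) : Scheme :=
  Spec (CommRingCat.of (MvPolynomial (Fin p × Fin q) ℂ))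

/-- A complex `p × q` matrix as a point of the scheme `Mat(p, q, ℂ)`. -/
def matPoint {p q : ℕ} (M : Matrix (Fin p) (Fin q) ℂ) : matSpace p q :=
  specPoint (eval fun ij : Fin p × Fin q => M ij.1 ij.2)

/-- The matrix `P Z Q`, where `Z` is the generic `p × q` matrix. -/
def genericMulMul {p q : ℕ} (P : Matrix (Fin p) (Fin p) ℂ) (Q : Matrix (Fin q) (Fin q) ℂ) :
    Matrix (Fin p) (Fin q) (MvPolynomial (Fin p × Fin q) ℂ) :=
  P.map (C : ℂ →+* MvPolynomial (Fin p × Fin q) ℂ) * mvPolynomialX (Fin p) (Fin q) ℂ *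
    Q.map (C : ℂ →+* MvPolynomial (Fin p × Fin q) ℂ)

/-- The morphism `Z ↦ P Z Q` from `Mat(p, q, ℂ)` to itself. -/
def mulMulMap {p q : ℕ} (P : Matrix (Fin p) (Fin p) ℂ) (Q : Matrix (Fin q) (Fin q) ℂ) :
    matSpace p q ⟶ matSpace p q :=
  Spec.map (CommRingCat.ofHom
    (bind₁ (fun ij : Fin p × Fin q => genericMulMul P Q ij.1 ij.2)).toRingHom)

/-! ### The groups of triangular matrices -/

/-- The group `B₋` of invertible lower triangular matrices. -/
def BMinus (k : ℕ) : Subgroup (GL (Fin k) ℂ) where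
  carrier := {b | (b : Matrix (Fin k) (Fin k) ℂ).IsLowerTriangular}
  one_mem' := blockTriangular_one
  mul_mem' := fun ha hb => by
    simpa using BlockTriangular.mul ha hb
  inv_mem' := fun {b} hb => by
    have : Invertible (b : Matrix (Fin k) (Fin k) ℂ) := b.invertible
    simpa using blockTriangular_inv_of_blockTriangular (M := (b : Matrix (Fin k) (Fin k) ℂ)) hb

/-- The group `B₊` of invertible upper triangular matrices. -/
def BPlus (k : ℕ) : Subgroup (GL (Fin k) ℂ) where
  carrier := {b | (b : Matrix (Fin k) (Fin k) ℂ).IsUpperTriangular}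
  one_mem' := blockTriangular_one
  mul_mem' := fun ha hb => by
    simpa using BlockTriangular.mul ha hb
  inv_mem' := fun {b} hb => by
    have : Invertible (b : Matrix (Fin k) (Fin k) ℂ) := b.invertible
    simpa using blockTriangular_inv_of_blockTriangular (M := (b : Matrix (Fin k) (Fin k) ℂ)) hb

/-! ### Partial permutation matrices and matrix Schubert varieties -/

/-- The `m × n` partial permutation matrix of an injection `π`: the `(i, j)` entry is `1` if
`π i = j` and `0` otherwise. -/
def permMat {m n : ℕ} (π : Fin m ↪ Fin n) : Matrix (Fin m) (Fin n) ℂ :=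
  Matrix.of fun i j => if π i = j then 1 else 0

/-- The permutation matrix of the longest element of the symmetric group on `k` letters. -/
def longest (k : ℕ) : Matrix (Fin k) (Fin k) ℂ :=
  Matrix.of fun i j => if Fin.rev i = j then 1 else 0

/-- The matrix Schubert variety of `w`: the Zariski closure of `B₋ w B₊` in `Mat(p, q, ℂ)`. -/
def matrixSchubert {p q : ℕ} (w : Matrix (Fin p) (Fin q) ℂ) : Set (matSpace p q) :=
  closure {x | ∃ b ∈ BMinus p, ∃ c ∈ BPlus q,
    x = matPoint ((b : Matrix (Fin p) (Fin p) ℂ) * w * (c : Matrix (Fin q) (Fin q) ℂ))}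

/-! ### The lower-upper scheme -/

section

variable (m n : ℕ)

/-- The matrix entries `X i j` (left summand) and `Y j i` (right summand). -/
abbrev Vars : Type := (Fin m × Fin n) ⊕ (Fin n × Fin m)

/-- The generic `m × n` matrix `X`. -/
def genX : Matrix (Fin m) (Fin n) (MvPolynomial (Vars m n) ℂ) :=
  Matrix.of fun i j => X (Sum.inl (i, j))

/-- The generic `n × m` matrix `Y`. -/
def genY : Matrix (Fin n) (Fin m) (MvPolynomial (Vars m n) ℂ) :=
  Matrix.of fun j i => X (Sum.inr (j, i))

/-- The equations of the lower-upper scheme: the entries of `X Y` above the diagonal and those of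
`Y X` below the diagonal. -/
def luIdeal : Ideal (MvPolynomial (Vars m n) ℂ) :=
  Ideal.span
    ({f | ∃ i i' : Fin m, i < i' ∧ f = (genX m n * genY m n) i i'} ∪
     {f | ∃ j j' : Fin n, j' < j ∧ f = (genY m n * genX m n) j j'})

/-- The coordinate ring of the lower-upper scheme. -/
abbrev luRing : Type := MvPolynomial (Vars m n) ℂ ⧸ luIdeal m n

/-- The lower-upper scheme `E`. -/
abbrev luScheme : Scheme := Spec (CommRingCat.of (luRing m n))

/-- The set `E(ℂ)` of pairs `(X, Y)` of complex matrices with `X Y` lower triangular and `Y X`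
upper triangular. -/
structure LUPair where
  X : Matrix (Fin m) (Fin n) ℂ
  Y : Matrix (Fin n) (Fin m) ℂ
  lower : (X * Y).IsLowerTriangular
  upper : (Y * X).IsUpperTriangular

/-- The projection `(X, Y) ↦ X` from `E` to `Mat(m, n, ℂ)`. -/
def projX : luScheme m n ⟶ matSpace m n :=
  Spec.map (CommRingCat.ofHom
    ((Ideal.Quotient.mk (luIdeal m n)).comp (rename (R := ℂ) Sum.inl).toRingHom))

/-- The projection `(X, Y) ↦ Y` from `E` to `Mat(n, m, ℂ)`. -/
def projY : luScheme m n ⟶ matSpace n m :=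
  Spec.map (CommRingCat.ofHom
    ((Ideal.Quotient.mk (luIdeal m n)).comp (rename (R := ℂ) Sum.inr).toRingHom))

end

variable {m n : ℕ}

/-- Evaluation of the coordinates of the ambient affine space at a pair `(X, Y)`. -/
def LUPair.evalAmbient (p : LUPair m n) : MvPolynomial (Vars m n) ℂ →+* ℂ :=
  eval (Sum.elim (fun ij => p.X ij.1 ij.2) (fun ji => p.Y ji.1 ji.2))

theorem LUPair.evalAmbient_eq_zero (p : LUPair m n) (f : MvPolynomial (Vars m n) ℂ)
    (hf : f ∈ luIdeal m n) : p.evalAmbient f = 0 := by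
  have h : luIdeal m n ≤ RingHom.ker p.evalAmbient := by
    rw [luIdeal, Ideal.span_le]
    rintro _ (⟨i, i', hi, rfl⟩ | ⟨j, j', hj, rfl⟩)
    · have := p.lower (i := i) (j := i') hi
      simpa [RingHom.mem_ker, Matrix.mul_apply, genX, genY, LUPair.evalAmbient] using this
    · have := p.upper (i := j) (j := j') hj
      simpa [RingHom.mem_ker, Matrix.mul_apply, genX, genY, LUPair.evalAmbient] using this
  exact h hf

/-- A pair `(X, Y)` in `E(ℂ)` as a point of the scheme `E`. -/
def LUPair.toPoint (p : LUPair m n) : luScheme m n :=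
  specPoint (Ideal.Quotient.lift (luIdeal m n) p.evalAmbient p.evalAmbient_eq_zero)

/-- The action of `B₋ × B₊` on `E(ℂ)`: `(b, c) · (X, Y) = (b X c⁻¹, c Y b⁻¹)`. -/
def act (b : BMinus m) (c : BPlus n) (p : LUPair m n) : LUPair m n where
  X := (b : GL (Fin m) ℂ).1 * p.X * ((c⁻¹ : BPlus n) : GL (Fin n) ℂ).1
  Y := (c : GL (Fin n) ℂ).1 * p.Y * ((b⁻¹ : BMinus m) : GL (Fin m) ℂ).1
  lower := by
    have h : (c⁻¹ : BPlus n).1.1 * c.1.1 = 1 := by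
      rw [← Units.val_mul, ← Subgroup.coe_mul]; simp
    have e : b.1.1 * p.X * (c⁻¹ : BPlus n).1.1 * (c.1.1 * p.Y * (b⁻¹ : BMinus m).1.1)
        = b.1.1 * (p.X * p.Y) * (b⁻¹ : BMinus m).1.1 := by
      calc _ = b.1.1 * p.X * ((c⁻¹ : BPlus n).1.1 * c.1.1) * p.Y * (b⁻¹ : BMinus m).1.1 := by
            simp only [Matrix.mul_assoc]
        _ = _ := by rw [h]; simp only [Matrix.mul_assoc, Matrix.mul_one]
    rw [e]
    exact (BlockTriangular.mul b.2 p.lower).mul (b⁻¹).2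
  upper := by
    have h : (b⁻¹ : BMinus m).1.1 * b.1.1 = 1 := by
      rw [← Units.val_mul, ← Subgroup.coe_mul]; simp
    have e : c.1.1 * p.Y * (b⁻¹ : BMinus m).1.1 * (b.1.1 * p.X * (c⁻¹ : BPlus n).1.1)
        = c.1.1 * (p.Y * p.X) * (c⁻¹ : BPlus n).1.1 := by
      calc _ = c.1.1 * p.Y * ((b⁻¹ : BMinus m).1.1 * b.1.1) * p.X * (c⁻¹ : BPlus n).1.1 := by
            simp only [Matrix.mul_assoc]
        _ = _ := by rw [h]; simp only [Matrix.mul_assoc, Matrix.mul_one]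
    rw [e]
    exact (BlockTriangular.mul c.2 p.upper).mul (c⁻¹).2

/-- The pair `(π, πᵀ s)` in `E(ℂ)`, where `s` is a diagonal `m × m` matrix. -/
def basePair (π : Fin m ↪ Fin n) (s : Fin m → ℂ) : LUPair m n where
  X := permMat π
  Y := (permMat π)ᵀ * Matrix.diagonal s
  lower := by
    intro i j hij
    have hne : i ≠ j := ne_of_lt (OrderDual.toDual_lt_toDual.mp hij)
    rw [← Matrix.mul_assoc, Matrix.mul_diagonal]
    simp only [permMat, Matrix.mul_apply, Matrix.of_apply, Matrix.transpose_apply,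
      EmbeddingLike.apply_eq_iff_eq, ite_mul, one_mul, zero_mul, Finset.sum_ite_eq,
      Finset.mem_univ, if_true, hne.symm, if_false]
  upper := by
    intro i j hij
    have hne : i ≠ j := ne_of_gt hij
    rw [Matrix.mul_apply]
    simp only [Matrix.mul_diagonal]
    refine Finset.sum_eq_zero fun k _ => ?_
    by_cases h1 : π k = i
    · have h2 : π k ≠ j := fun h => hne (h1.symm.trans h)
      simp [permMat, h2]
    · simp [permMat, h1]

/-- `E_π`: the Zariski closure in `E` of the set of pairs `(X, Y)` in `E(ℂ)` for which
`(Y X)_{π(i) π(i)} = (X Y)_{i i}` for all `i`, these numbers being distinct and nonzero. -/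
def luComponent (π : Fin m ↪ Fin n) : Set (luScheme m n) :=
  closure (LUPair.toPoint '' {p : LUPair m n |
    (∀ i, (p.Y * p.X) (π i) (π i) = (p.X * p.Y) i i) ∧
    (Function.Injective fun i => (p.X * p.Y) i i) ∧
    (∀ i, (p.X * p.Y) i i ≠ 0)})

/-- The `B₋ × B₊`-orbit of the set of all `(π, πᵀ s)` with `s` diagonal. -/
def orbitSet (π : Fin m ↪ Fin n) : Set (LUPair m n) :=
  {p | ∃ (b : BMinus m) (c : BPlus n) (s : Fin m → ℂ), p = act b c (basePair π s)}

end LowerUpper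

end

/-!
The closures `E_π` are controlled by the matrix `X`. By Gaussian elimination (`exists_bruhat`)
every `m × n` matrix is `b w c` with `b ∈ B₋`, `c ∈ B₊` and `w` a partial permutation matrix, and
the pairs `(X, Y)` in `E` with a fixed `X`, or with a fixed `Y`, form a linear space. This makes
affine lines in `E` available, and a polynomial vanishing at almost all points of a line vanishes
on it (`toPoint_mem_closure_of_line`).

*Covering.* Since `w` extends to the matrix of an injection, for every `X` there is some `Y₀` of
full rank with `(X, Y₀)` in `E`. Transposing and reversing rows and columns exchanges the roles of
`X` and `Y`, so for every `Y` there is some `X₀` of full rank with `(X₀, Y)` in `E`, and moving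
along `X + t X₀` makes `X` of full rank. A pair with `X = b π c` is, up to the group action, of
the form `(π, Y)`, and adding `t πᵀ s` to `Y` moves it into the generic locus of `E_π`. With the
Nullstellensatz the `E_π` cover `E` (`iUnion_luComponent`). They are pairwise incomparable because
`(YX)_{π(i)π(i)} = (XY)_{ii}` is a closed condition that determines `π` at a generic pair.

*Orbits.* For a generic pair the diagonal of `YX` is known completely, by comparison of
characteristic polynomials. Rows of suitable polynomials in `XY` and `YX` are left eigenvectors,
and they form triangular matrices `b` and `c` that diagonalize `XY` and `YX`. Then `X` and `Y`
intertwine two diagonal matrices, so they are supported on `π` (`genericSet_subset_orbitSet`).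

*Irreducibility and dimension.* The pairs `(b π c, c⁻¹ V b⁻¹)`, with `c` in a normal form that makes
it unique and `V` in a coordinate subspace, are parametrized by an open subset of an affine
space of dimension `∑ᵢ ((i + 1) + (n - i)) = m (n + 1)`, where `i` runs over `0, …, m - 1`. The
generic pairs of `E_π` are among them, and all of them lie in `E_π`; hence the coordinate ring of
`E_π` is a subalgebra of a polynomial ring. The parameters are rational functions of `X` and `Y`
(`param_mem_of_entries_mem`), so both rings have the same transcendence degree, which is the Krull
dimension by Noether normalization.

*Projections.* The sections `X ↦ (X, 0)` and `Y ↦ (0, Y)` send the orbits `B₋ π B₊` and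
`B₊ πᵀ B₋` into `E_π`, hence also the closures of these orbits; therefore the projections of
`E_π` are onto these closures.
-/

/-! ### Krull dimension and transcendence degree -/

section KrullDimension

open MvPolynomial

/-- Lying over, incomparability and going up for integral extensions. -/
theorem ringKrullDim_eq_of_injective_of_isIntegral {R S : Type*} [CommRing R] [CommRing S]
    [Algebra R S] [Algebra.IsIntegral R S] (hinj : Function.Injective (algebraMap R S)) :
    ringKrullDim S = ringKrullDim R := by
  apply le_antisymm
  · refine Order.krullDim_le_of_strictMono (PrimeSpectrum.comap (algebraMap R S)) ?_
    intro P Q hPQ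
    exact Ideal.IsIntegral.comap_lt_comap (R := R) (I := P.asIdeal) (J := Q.asIdeal) hPQ
  · refine iSup_le fun l => ?_
    obtain ⟨P, hP, hlo⟩ := Ideal.exists_ideal_over_prime_of_isIntegral l.head.asIdeal (⊥ : Ideal S)
      (by
        rw [← RingHom.ker_eq_comap_bot, (RingHom.injective_iff_ker_eq_bot _).mp hinj]
        exact bot_le)
    have : P.LiesOver l.head.asIdeal := ⟨hlo.2.symm⟩
    have := hlo.1
    obtain ⟨L, hL, -⟩ := Ideal.exists_ltSeries_of_hasGoingUp l P
    rw [← hL]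
    exact le_iSup (fun p : LTSeries (PrimeSpectrum S) => (p.length : WithBot ℕ∞)) L

/-- By Noether normalization, the dimension of a finitely generated domain over a field is its
transcendence degree. -/
theorem ringKrullDim_eq_of_trdeg_eq (k : Type) {A : Type} [Field k] [CommRing A] [IsDomain A]
    [Algebra k A] [Algebra.FiniteType k A] {d : ℕ} (h : Algebra.trdeg k A = d) :
    ringKrullDim A = d := by
  obtain ⟨s, g, hg, hint⟩ := exists_integral_inj_algHom_of_fg k A
  algebraize [g.toRingHom]
  have hinj : Function.Injective (algebraMap (MvPolynomial (Fin s) k) A) := hg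
  have : FaithfulSMul (MvPolynomial (Fin s) k) A :=
    (faithfulSMul_iff_algebraMap_injective _ _).mpr hinj
  have hadd := _root_.trdeg_add_eq k (MvPolynomial (Fin s) k) (A := A)
  rw [_root_.trdeg_eq_zero (R := MvPolynomial (Fin s) k) (A := A), add_zero,
    MvPolynomial.trdeg_of_isDomain, h] at hadd
  have hs : s = d := by simpa using hadd
  rw [ringKrullDim_eq_of_injective_of_isIntegral hinj]
  simp [hs]

/-- A finitely generated subalgebra of a polynomial ring over which the variables are rational has
the dimension of the polynomial ring. -/
theorem ringKrullDim_range_eq_card {k : Type} [Field k] {ι σ : Type} [Finite ι] [Fintype σ]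
    (φ : MvPolynomial ι k →ₐ[k] MvPolynomial σ k)
    (h : ∀ s, algebraMap (MvPolynomial σ k) (FractionRing (MvPolynomial σ k)) (X s) ∈
      IntermediateField.adjoin k
        (Set.range fun i =>
          algebraMap (MvPolynomial σ k) (FractionRing (MvPolynomial σ k)) (φ (X i)))) :
    ringKrullDim φ.range = Fintype.card σ := by
  set K := FractionRing (MvPolynomial σ k)
  have hft : Algebra.FiniteType k φ.range :=
    Algebra.FiniteType.of_surjective φ.rangeRestrict φ.rangeRestrict_surjective
  apply ringKrullDim_eq_of_trdeg_eq k
  have : FaithfulSMul φ.range K := by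
    rw [faithfulSMul_iff_algebraMap_injective]
    exact (FaithfulSMul.algebraMap_injective (MvPolynomial σ k) K).comp Subtype.val_injective
  have halg0 : ∀ x ∈ IntermediateField.adjoin k
      (Set.range fun i => algebraMap _ K (φ (X i))), IsAlgebraic φ.range x := by
    intro x hx
    induction hx using IntermediateField.adjoin_induction with
    | mem x hx =>
      obtain ⟨i, rfl⟩ := hx
      exact isAlgebraic_algebraMap (⟨φ (X i), X i, rfl⟩ : φ.range)
    | algebraMap x =>
      rw [IsScalarTower.algebraMap_apply k φ.range K]
      exact isAlgebraic_algebraMap _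
    | add x y _ _ hx hy => exact hx.add hy
    | inv x _ hx => exact hx.inv
    | mul x y _ _ hx hy => exact hx.mul hy
  have hpoly : ∀ p : MvPolynomial σ k, IsAlgebraic φ.range (algebraMap _ K p) := by
    intro p
    induction p using MvPolynomial.induction_on with
    | C a =>
      rw [← MvPolynomial.algebraMap_eq, ← IsScalarTower.algebraMap_apply,
        IsScalarTower.algebraMap_apply k φ.range K]
      exact isAlgebraic_algebraMap _
    | add p q hp hq => rw [map_add]; exact hp.add hq
    | mul_X p s hp => rw [map_mul]; exact hp.mul (halg0 _ (h s))
  have halg : Algebra.IsAlgebraic φ.range K := by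
    refine ⟨fun x => ?_⟩
    obtain ⟨p, q, -, rfl⟩ := IsFractionRing.div_surjective (A := MvPolynomial σ k) x
    rw [div_eq_mul_inv]
    exact (hpoly p).mul (hpoly q).inv
  have halg' : Algebra.IsAlgebraic (MvPolynomial σ k) K := by
    refine ⟨fun x => ?_⟩
    obtain ⟨p, q, -, rfl⟩ := IsFractionRing.div_surjective (A := MvPolynomial σ k) x
    rw [div_eq_mul_inv]
    exact (isAlgebraic_algebraMap p).mul (isAlgebraic_algebraMap q).inv
  have h1 := _root_.trdeg_add_eq k φ.range (A := K)
  have h2 := _root_.trdeg_add_eq k (MvPolynomial σ k) (A := K)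
  rw [_root_.trdeg_eq_zero (R := φ.range), add_zero] at h1
  rw [_root_.trdeg_eq_zero (R := MvPolynomial σ k), add_zero] at h2
  rw [h1, ← h2, MvPolynomial.trdeg_of_isDomain]
  simp

theorem topologicalKrullDim_zeroLocus_ker {R S : Type*} [CommRing R] [CommRing S] (f : R →+* S)
    (hf : Function.Surjective f) :
    topologicalKrullDim (PrimeSpectrum.zeroLocus (RingHom.ker f : Set R)) = ringKrullDim S := by
  rw [← PrimeSpectrum.topologicalKrullDim_eq_ringKrullDim, ← range_comap_of_surjective _ f hf]
  exact (IsHomeomorph.topologicalKrullDim_eq _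
    (PrimeSpectrum.isEmbedding_comap_of_surjective S f hf).toHomeomorph.isHomeomorph).symm

end KrullDimension

noncomputable section

namespace LowerUpper

open Matrix MvPolynomial AlgebraicGeometry CategoryTheory

/-! ### Triangular matrices -/

section Triangular

variable {k : ℕ} {R : Type*} [CommRing R]

theorem upper_mul_diag {A B : Matrix (Fin k) (Fin k) R} (hA : A.IsUpperTriangular)
    (hB : B.IsUpperTriangular) (i : Fin k) : (A * B) i i = A i i * B i i := by
  rw [Matrix.mul_apply]
  refine Finset.sum_eq_single i (fun j _ hj => ?_) (by simp)
  rcases lt_or_gt_of_ne hj with h | h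
  · rw [hA (i := i) (j := j) h, zero_mul]
  · rw [hB (i := j) (j := i) h, mul_zero]

theorem lower_mul_diag {A B : Matrix (Fin k) (Fin k) R} (hA : A.IsLowerTriangular)
    (hB : B.IsLowerTriangular) (i : Fin k) : (A * B) i i = A i i * B i i := by
  rw [Matrix.mul_apply]
  refine Finset.sum_eq_single i (fun j _ hj => ?_) (by simp)
  rcases lt_or_gt_of_ne hj with h | h
  · rw [hB (i := j) (j := i) h, mul_zero]
  · rw [hA (i := i) (j := j) h, zero_mul]

theorem upper_conj_diag {A B C : Matrix (Fin k) (Fin k) R} (hA : A.IsUpperTriangular)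
    (hB : B.IsUpperTriangular) (hC : C.IsUpperTriangular) (h : A * C = 1) (i : Fin k) :
    (A * B * C) i i = B i i := by
  have h1 : A i i * C i i = 1 := by rw [← upper_mul_diag hA hC, h, one_apply_eq]
  rw [upper_mul_diag (hA.mul hB) hC, upper_mul_diag hA hB, mul_right_comm, h1, one_mul]

theorem lower_conj_diag {A B C : Matrix (Fin k) (Fin k) R} (hA : A.IsLowerTriangular)
    (hB : B.IsLowerTriangular) (hC : C.IsLowerTriangular) (h : A * C = 1) (i : Fin k) :
    (A * B * C) i i = B i i := by
  have h1 : A i i * C i i = 1 := by rw [← lower_mul_diag hA hC, h, one_apply_eq]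
  rw [lower_mul_diag (BlockTriangular.mul hA hB) hC, lower_mul_diag hA hB, mul_right_comm, h1,
    one_mul]

theorem BMinus.inv_mul (b : BMinus k) : (b⁻¹ : BMinus k).1.1 * b.1.1 = 1 := by
  rw [← Units.val_mul, ← Subgroup.coe_mul]; simp

theorem BMinus.mul_inv (b : BMinus k) : b.1.1 * (b⁻¹ : BMinus k).1.1 = 1 := by
  rw [← Units.val_mul, ← Subgroup.coe_mul]; simp

theorem BPlus.inv_mul (b : BPlus k) : (b⁻¹ : BPlus k).1.1 * b.1.1 = 1 := by
  rw [← Units.val_mul, ← Subgroup.coe_mul]; simp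

theorem BPlus.mul_inv (b : BPlus k) : b.1.1 * (b⁻¹ : BPlus k).1.1 = 1 := by
  rw [← Units.val_mul, ← Subgroup.coe_mul]; simp

theorem BMinus.exists_coe_eq (A : Matrix (Fin k) (Fin k) ℂ) (hA : A.IsLowerTriangular)
    (hd : ∀ i, A i i ≠ 0) : ∃ b : BMinus k, b.1.1 = A :=
  ⟨⟨GeneralLinearGroup.mkOfDetNeZero A (by
    rw [det_of_isLowerTriangular A hA]
    exact Finset.prod_ne_zero_iff.mpr fun i _ => hd i), hA⟩, rfl⟩

theorem BPlus.exists_coe_eq (A : Matrix (Fin k) (Fin k) ℂ) (hA : A.IsUpperTriangular)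
    (hd : ∀ i, A i i ≠ 0) : ∃ b : BPlus k, b.1.1 = A :=
  ⟨⟨GeneralLinearGroup.mkOfDetNeZero A (by
    rw [det_of_isUpperTriangular hA]
    exact Finset.prod_ne_zero_iff.mpr fun i _ => hd i), hA⟩, rfl⟩

theorem BMinus.det_ne_zero (b : BMinus k) : b.1.1.det ≠ 0 := fun h => by
  have := congrArg det (BMinus.mul_inv b)
  rw [det_mul, h, zero_mul, det_one] at this
  exact zero_ne_one this

theorem BMinus.diag_ne_zero (b : BMinus k) (i : Fin k) : b.1.1 i i ≠ 0 := by
  have := BMinus.det_ne_zero b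
  rw [det_of_isLowerTriangular _ b.2] at this
  exact Finset.prod_ne_zero_iff.mp this i (Finset.mem_univ i)

end Triangular

/-! ### The matrix of an injection -/

section InjMatrix

variable {m n : ℕ} (R : Type*) [CommRing R] (π : Fin m ↪ Fin n)

/-- The matrix of the injection `π` over an arbitrary commutative ring. -/
def injMatrix : Matrix (Fin m) (Fin n) R :=
  Matrix.of fun i j => if π i = j then 1 else 0

theorem permMat_eq_injMatrix : permMat π = injMatrix ℂ π := rfl

variable {R}

theorem injMatrix_mul_apply {l : Type*} (A : Matrix (Fin n) l R) (i : Fin m) (j : l) :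
    (injMatrix R π * A) i j = A (π i) j := by
  simp [injMatrix, Matrix.mul_apply]

theorem mul_injMatrix_apply {l : Type*} (A : Matrix l (Fin m) R) (i : l) (k : Fin m) :
    (A * injMatrix R π) i (π k) = A i k := by
  simp [injMatrix, Matrix.mul_apply]

theorem mul_injMatrix_apply_of_notMem {l : Type*} (A : Matrix l (Fin m) R) (i : l) {j : Fin n}
    (hj : ∀ k, π k ≠ j) : (A * injMatrix R π) i j = 0 := by
  simp [injMatrix, Matrix.mul_apply, hj]

theorem injMatrix_transpose_mul_apply {l : Type*} (A : Matrix (Fin m) l R) (k : Fin m) (j : l) :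
    ((injMatrix R π)ᵀ * A) (π k) j = A k j := by
  simp [injMatrix, Matrix.mul_apply]

theorem injMatrix_transpose_mul_apply_of_notMem {l : Type*} (A : Matrix (Fin m) l R) {i : Fin n}
    (hi : ∀ k, π k ≠ i) (j : l) : ((injMatrix R π)ᵀ * A) i j = 0 := by
  simp [injMatrix, Matrix.mul_apply, hi]

theorem injMatrix_mul_transpose : injMatrix R π * (injMatrix R π)ᵀ = 1 := by
  ext i j
  rw [injMatrix_mul_apply]
  simp [injMatrix, Matrix.one_apply, eq_comm]

/-- The upper triangular unipotent matrix whose rows with index in the image of `π` are the rows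
of `π + N`, the other rows being those of the identity matrix. -/
def unipotent (N : Matrix (Fin m) (Fin n) R) : Matrix (Fin n) (Fin n) R :=
  1 + (injMatrix R π)ᵀ * N

theorem injMatrix_mul_unipotent (N : Matrix (Fin m) (Fin n) R) :
    injMatrix R π * unipotent π N = injMatrix R π + N := by
  rw [unipotent, Matrix.mul_add, Matrix.mul_one, ← Matrix.mul_assoc, injMatrix_mul_transpose,
    Matrix.one_mul]

variable {π}

theorem injMatrix_transpose_mul_eq_zero {N : Matrix (Fin m) (Fin n) R}
    (hN : ∀ i j, j ≤ π i → N i j = 0) {i j : Fin n} (hij : j ≤ i) :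
    ((injMatrix R π)ᵀ * N) i j = 0 := by
  by_cases h : ∃ k, π k = i
  · obtain ⟨k, rfl⟩ := h
    rw [injMatrix_transpose_mul_apply]
    exact hN k j hij
  · push Not at h
    exact injMatrix_transpose_mul_apply_of_notMem π N h j

theorem unipotent_upper {N : Matrix (Fin m) (Fin n) R} (hN : ∀ i j, j ≤ π i → N i j = 0) :
    (unipotent π N).IsUpperTriangular := by
  intro i j hij
  have hij' : j < i := hij
  simp [unipotent, injMatrix_transpose_mul_eq_zero hN hij'.le, hij'.ne']

theorem unipotent_diag {N : Matrix (Fin m) (Fin n) R} (hN : ∀ i j, j ≤ π i → N i j = 0)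
    (i : Fin n) : unipotent π N i i = 1 := by
  simp [unipotent, injMatrix_transpose_mul_eq_zero hN le_rfl]

theorem det_unipotent {N : Matrix (Fin m) (Fin n) R} (hN : ∀ i j, j ≤ π i → N i j = 0) :
    (unipotent π N).det = 1 := by
  rw [det_of_isUpperTriangular (unipotent_upper hN)]
  simp [unipotent_diag hN]

end InjMatrix

/-! ### The Bruhat decomposition -/

section Bruhat

variable {m n : ℕ}

/-- The `i`-th row of `M` is zero, or its first nonzero entry is `1` and all entries of `M` below
this one vanish. -/
def IsReducedRow (M : Matrix (Fin m) (Fin n) ℂ) (i : Fin m) : Prop :=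
  (∀ j, M i j = 0) ∨ ∃ p, M i p = 1 ∧ (∀ j < p, M i j = 0) ∧ ∀ i' > i, M i' p = 0

/-- One step of Gaussian elimination: row `k` is scaled to have leading entry `1` and is used to
clear the column of this entry below it. -/
theorem exists_reduceRow (M : Matrix (Fin m) (Fin n) ℂ) (k : Fin m)
    (hM : ∀ i < k, IsReducedRow M i) :
    ∃ b : BMinus m, ∀ i ≤ k, IsReducedRow (b.1.1 * M) i := by
  by_cases h0 : ∀ j, M k j = 0
  · refine ⟨1, fun i hi => ?_⟩
    have e : (1 : BMinus m).1.1 * M = M := by simp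
    rw [e]
    rcases hi.lt_or_eq with h | rfl
    · exact hM i h
    · exact Or.inl h0
  push Not at h0
  obtain ⟨p, hp, hmin⟩ := wellFounded_lt.has_min {j | M k j ≠ 0} h0
  have hp : M k p ≠ 0 := hp
  have hmin' : ∀ j < p, M k j = 0 := fun j hj => by
    by_contra h
    exact hmin j h hj
  -- `u` is the `k`-th column of the elimination matrix minus that of the identity matrix
  set u : Fin m → ℂ := fun i => if i < k then 0 else if i = k then (M k p)⁻¹ - 1
    else - M i p / M k p with hu
  have huk : u k = (M k p)⁻¹ - 1 := by simp [hu]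
  have hult : ∀ i < k, u i = 0 := fun i hi => by simp [hu, hi]
  have hugt : ∀ i, k < i → u i = - M i p / M k p := fun i hi => by
    simp [hu, hi.not_gt, hi.ne']
  obtain ⟨b, hb⟩ := BMinus.exists_coe_eq
    (1 + Matrix.of fun i l : Fin m => u i * if l = k then 1 else 0) (by
      intro i j hij
      have hij' : i < j := hij
      by_cases hj : j = k
      · subst hj
        simp [hij'.ne, hult i hij']
      · simp [hij'.ne, hj]) (by
      intro i
      by_cases hi : i = k
      · subst hi
        simp [huk, hp]
      · simp [hi])
  have hbM : ∀ i j, (b.1.1 * M) i j = M i j + u i * M k j := by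
    intro i j
    rw [hb, Matrix.add_mul, Matrix.one_mul, Matrix.add_apply, Matrix.mul_apply]
    congr 1
    simp
  refine ⟨b, fun i hi => ?_⟩
  rcases hi.lt_or_eq with h | rfl
  · rcases hM i h with h1 | ⟨q, hq, hq1, hq2⟩
    · left
      intro j
      rw [hbM, hult i h, h1]; simp
    · right
      refine ⟨q, ?_, fun j hj => ?_, fun i' hi' => ?_⟩
      · rw [hbM, hult i h, hq]; simp
      · rw [hbM, hult i h, hq1 j hj]; simp
      · rw [hbM, hq2 i' hi', hq2 k h]; simp
  · right
    refine ⟨p, ?_, fun j hj => ?_, fun i' hi' => ?_⟩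
    · rw [hbM, huk]; field_simp; ring
    · rw [hbM, hmin' j hj]; simp
    · rw [hbM, hugt i' hi']; field_simp; ring

theorem exists_reduced (X : Matrix (Fin m) (Fin n) ℂ) (k : ℕ) :
    ∃ b : BMinus m, ∀ i : Fin m, i.1 < k → IsReducedRow (b.1.1 * X) i := by
  induction k with
  | zero => exact ⟨1, fun i hi => absurd hi (Nat.not_lt_zero _)⟩
  | succ k ih =>
    obtain ⟨b, hb⟩ := ih
    by_cases hk : k < m
    · obtain ⟨b', hb'⟩ := exists_reduceRow (b.1.1 * X) ⟨k, hk⟩ fun i hi => hb i hi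
      refine ⟨b' * b, fun i hi => ?_⟩
      have := hb' i (Nat.lt_succ_iff.mp hi)
      rwa [← Matrix.mul_assoc] at this
    · exact ⟨b, fun i _ => hb i (by omega)⟩

/-- A partially defined injection `Fin m → Fin n` extends to a total one when `m ≤ n`. -/
theorem exists_extend_embedding (hmn : m ≤ n) (s : Finset (Fin m)) (p : Fin m → Fin n)
    (hp : Set.InjOn p s) : ∃ π : Fin m ↪ Fin n, ∀ i ∈ s, π i = p i := by
  obtain ⟨t, hst, ht⟩ := Finset.exists_superset_card_eq (s := s.image p) (n := m)
    (Finset.card_image_le.trans (by simpa using Finset.card_le_univ s)) (by simpa using hmn)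
  obtain ⟨g, hg⟩ := Finset.exists_equiv_extend_of_card_eq (t := t) (by simp [ht]) hst hp
  exact ⟨g.toEmbedding.trans (Function.Embedding.subtype _), hg⟩

/-- Bruhat decomposition with a normal form of the upper triangular factor. The partial permutation
matrix is written as `diagonal ε * π`, where the zeros of `ε` mark its zero rows. -/
theorem exists_bruhat (hmn : m ≤ n) (X : Matrix (Fin m) (Fin n) ℂ) :
    ∃ (b : BMinus m) (π : Fin m ↪ Fin n) (ε : Fin m → ℂ) (N : Matrix (Fin m) (Fin n) ℂ),
      (∀ i j, j ≤ π i → N i j = 0) ∧ (∀ i i', i' < i → ε i' ≠ 0 → N i (π i') = 0) ∧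
      (∀ i, ε i = 0 ∨ ε i = 1) ∧
      X = b.1.1 * (diagonal ε * (injMatrix ℂ π * unipotent π N)) := by
  classical
  obtain ⟨b, hb⟩ := exists_reduced X m
  set M := b.1.1 * X with hM
  have hb' : ∀ i, (∃ j, M i j ≠ 0) →
      ∃ p, M i p = 1 ∧ (∀ j < p, M i j = 0) ∧ ∀ i' > i, M i' p = 0 := by
    rintro i ⟨j, hj⟩
    rcases hb i i.2 with h | h
    · exact absurd (h j) hj
    · exact h
  -- the value of the pivot function `p` at a zero row is irrelevant
  choose! p hp1 hp2 hp3 using (show ∀ i, ∃ q, (∃ j, M i j ≠ 0) →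
      M i q = 1 ∧ (∀ j < q, M i j = 0) ∧ ∀ i' > i, M i' q = 0 from fun i => by
    by_cases h : ∃ j, M i j ≠ 0
    · obtain ⟨q, hq⟩ := hb' i h
      exact ⟨q, fun _ => hq⟩
    · exact ⟨Fin.castLE hmn i, fun h' => absurd h' h⟩)
  set s : Finset (Fin m) := Finset.univ.filter fun i => ∃ j, M i j ≠ 0 with hs
  have hinj : Set.InjOn p s := by
    intro i hi i' hi' h
    simp only [hs, Finset.coe_filter, Finset.mem_univ, true_and, Set.mem_ofPred_eq] at hi hi'
    by_contra hne
    rcases lt_or_gt_of_ne hne with h1 | h1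
    · have := hp3 i hi i' h1
      rw [h, hp1 i' hi'] at this
      exact one_ne_zero this
    · have := hp3 i' hi' i h1
      rw [← h, hp1 i hi] at this
      exact one_ne_zero this
  obtain ⟨π, hπ⟩ := exists_extend_embedding hmn s p hinj
  have hπ' : ∀ i, (∃ j, M i j ≠ 0) → π i = p i := fun i hi => hπ i (by simp [hs, hi])
  refine ⟨b⁻¹, π, fun i => if ∃ j, M i j ≠ 0 then 1 else 0,
    Matrix.of fun i j => if ∃ j, M i j ≠ 0 then M i j - injMatrix ℂ π i j else 0, ?_, ?_, ?_, ?_⟩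
  · intro i j hij
    rw [Matrix.of_apply]
    split_ifs with h
    · rw [hπ' i h] at hij
      rcases hij.lt_or_eq with h1 | rfl
      · simp [injMatrix, hπ' i h, h1.ne', hp2 i h j h1]
      · simp [injMatrix, hπ' i h, hp1 i h]
    · rfl
  · intro i i' hi hε
    rw [Matrix.of_apply]
    dsimp only at hε
    have h' : ∃ j, M i' j ≠ 0 := by
      by_contra h
      simp [h] at hε
    split_ifs with h
    · rw [hπ' i' h', hp3 i' h' i hi, ← hπ' i' h']
      simp [injMatrix, hi.ne']
    · rfl
  · intro i
    dsimp only
    split_ifs <;> simp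
  · rw [injMatrix_mul_unipotent]
    have : M = diagonal (fun i => if ∃ j, M i j ≠ 0 then (1 : ℂ) else 0) *
        (injMatrix ℂ π +
          Matrix.of fun i j => if ∃ j, M i j ≠ 0 then M i j - injMatrix ℂ π i j else 0) := by
      ext i j
      rw [diagonal_mul, Matrix.add_apply, Matrix.of_apply]
      by_cases h : ∃ j, M i j ≠ 0
      · simp only [if_pos h]; ring
      · simp only [if_neg h]
        push Not at h
        simp [h j]
    rw [← this, hM, ← Matrix.mul_assoc, BMinus.inv_mul, Matrix.one_mul]

/-- For a matrix of full rank, the factor in the middle of the Bruhat decomposition is the matrix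
of an injection. -/
theorem exists_bruhat_of_mul_eq_one (hmn : m ≤ n) (X : Matrix (Fin m) (Fin n) ℂ)
    (Z : Matrix (Fin n) (Fin m) ℂ) (hXZ : X * Z = 1) :
    ∃ (b : BMinus m) (π : Fin m ↪ Fin n) (N : Matrix (Fin m) (Fin n) ℂ),
      (∀ i j, j ≤ π i → N i j = 0) ∧ (∀ i i', i' < i → N i (π i') = 0) ∧
      X = b.1.1 * (injMatrix ℂ π * unipotent π N) := by
  obtain ⟨b, π, ε, N, h1, h2, h3, rfl⟩ := exists_bruhat hmn X
  have hε : ∀ i, ε i = 1 := by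
    intro i
    refine (h3 i).resolve_left fun h => ?_
    have := congrArg det hXZ
    rw [Matrix.mul_assoc, Matrix.mul_assoc, det_mul, det_mul, det_diagonal,
      Finset.prod_eq_zero (Finset.mem_univ i) h] at this
    simp at this
  have hε' : diagonal ε = 1 := by
    rw [show ε = fun _ => 1 from funext hε, diagonal_one]
  exact ⟨b, π, N, h1, fun i i' h => h2 i i' h (by simp [hε]), by rw [hε', Matrix.one_mul]⟩

end Bruhat

/-! ### Closures of sets of complex points -/

section Points

variable {m n : ℕ}

theorem LUPair.ext' {p q : LUPair m n} (hX : p.X = q.X) (hY : p.Y = q.Y) : p = q := by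
  cases p; cases q; cases hX; cases hY; rfl

theorem mem_closure_iff_forall_mem_asIdeal {A : Type*} [CommRing A] {T : Set (PrimeSpectrum A)}
    {x : PrimeSpectrum A} :
    x ∈ closure T ↔ ∀ f : A, (∀ y ∈ T, f ∈ y.asIdeal) → f ∈ x.asIdeal := by
  rw [← PrimeSpectrum.zeroLocus_vanishingIdeal_eq_closure, PrimeSpectrum.mem_zeroLocus]
  exact forall_congr' fun f => by rw [SetLike.mem_coe, PrimeSpectrum.mem_vanishingIdeal]; rfl

theorem mem_closure_toPoint_iff {S : Set (LUPair m n)} {x : luScheme m n} :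
    x ∈ closure (LUPair.toPoint '' S) ↔ ∀ f : MvPolynomial (Vars m n) ℂ,
      (∀ q ∈ S, q.evalAmbient f = 0) →
        Ideal.Quotient.mk (luIdeal m n) f ∈ (x : PrimeSpectrum (luRing m n)).asIdeal := by
  refine (mem_closure_iff_forall_mem_asIdeal (A := luRing m n) (x := x)).trans ⟨?_, ?_⟩
  · intro h f hf
    apply h
    rintro _ ⟨q, hq, rfl⟩
    exact hf q hq
  · intro h f hf
    obtain ⟨f, rfl⟩ := Ideal.Quotient.mk_surjective f
    exact h f fun q hq => hf _ ⟨q, hq, rfl⟩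

theorem toPoint_mem_closure_iff {S : Set (LUPair m n)} {p : LUPair m n} :
    p.toPoint ∈ closure (LUPair.toPoint '' S) ↔ ∀ f : MvPolynomial (Vars m n) ℂ,
      (∀ q ∈ S, q.evalAmbient f = 0) → p.evalAmbient f = 0 :=
  mem_closure_toPoint_iff

/-- The complex points are dense in the lower-upper scheme, by the Nullstellensatz. -/
theorem closure_range_toPoint :
    closure (LUPair.toPoint '' (Set.univ : Set (LUPair m n))) = Set.univ := by
  refine Set.eq_univ_of_forall fun x => mem_closure_toPoint_iff.mpr fun f hf => ?_
  have hrad : f ∈ (luIdeal m n).radical := by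
    rw [← vanishingIdeal_zeroLocus_eq_radical (K := ℂ), mem_vanishingIdeal_iff]
    intro v hv
    have hgen : ∀ g ∈ luIdeal m n, eval v g = 0 := fun g hg => by
      simpa [aeval_eq_eval] using hv g hg
    have hv' : Sum.elim (fun ij : Fin m × Fin n => v (Sum.inl (ij.1, ij.2)))
        (fun ji : Fin n × Fin m => v (Sum.inr (ji.1, ji.2))) = v := by
      funext i
      rcases i with i | i <;> rfl
    have h := hf ⟨Matrix.of fun i j => v (Sum.inl (i, j)), Matrix.of fun j i => v (Sum.inr (j, i)),
      fun i i' hi => by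
        have := hgen _ (Ideal.subset_span (Or.inl ⟨i, i', hi, rfl⟩))
        simpa [Matrix.mul_apply, genX, genY] using this,
      fun j j' hj => by
        have := hgen _ (Ideal.subset_span (Or.inr ⟨j, j', hj, rfl⟩))
        simpa [Matrix.mul_apply, genX, genY] using this⟩ (Set.mem_univ _)
    rw [aeval_eq_eval]
    rw [LUPair.evalAmbient] at h
    simp only [Matrix.of_apply] at h
    rwa [hv'] at h
  obtain ⟨k, hk⟩ := hrad
  refine x.isPrime.mem_of_pow_mem k ?_
  rw [← map_pow, Ideal.Quotient.eq_zero_iff_mem.mpr hk]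
  exact Ideal.zero_mem _

/-- A point on an affine line in `E` lies in a closed set that contains all but finitely many
points of the line. -/
theorem toPoint_mem_closure_of_line {S : Set (LUPair m n)} (q : ℂ → LUPair m n)
    (X₀ X₁ : Matrix (Fin m) (Fin n) ℂ) (Y₀ Y₁ : Matrix (Fin n) (Fin m) ℂ)
    (hX : ∀ t, (q t).X = X₀ + t • X₁) (hY : ∀ t, (q t).Y = Y₀ + t • Y₁)
    {B : Set ℂ} (hB : B.Finite)
    (h : ∀ t ∉ B, (q t).toPoint ∈ closure (LUPair.toPoint '' S)) :
    (q 0).toPoint ∈ closure (LUPair.toPoint '' S) := by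
  rw [toPoint_mem_closure_iff]
  intro f hf
  set P : Polynomial ℂ := aeval (Sum.elim
    (fun ij : Fin m × Fin n => Polynomial.C (X₀ ij.1 ij.2) + Polynomial.X *
      Polynomial.C (X₁ ij.1 ij.2))
    (fun ji : Fin n × Fin m => Polynomial.C (Y₀ ji.1 ji.2) + Polynomial.X *
      Polynomial.C (Y₁ ji.1 ji.2))) f with hP
  have heval : ∀ t, P.eval t = (q t).evalAmbient f := by
    intro t
    rw [← Polynomial.coe_evalRingHom, hP, ← Polynomial.coe_aeval_eq_evalRingHom,
      RingHom.coe_coe, ← AlgHom.comp_apply, comp_aeval, LUPair.evalAmbient, ← aeval_eq_eval]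
    congr 2
    funext i
    rcases i with i | i <;> simp [hX, hY] <;> exact mul_comm _ _
  have hzero : P = 0 := by
    apply Polynomial.eq_zero_of_infinite_isRoot
    refine Set.Infinite.mono (s := Bᶜ) (fun t ht => ?_) hB.infinite_compl
    rw [Set.mem_ofPred_eq, Polynomial.IsRoot.def, heval]
    exact toPoint_mem_closure_iff.mp (h t ht) f hf
  rw [← heval, hzero, Polynomial.eval_zero]

end Points

/-! ### Density of the pairs with `X` of full rank -/

section FullRank

variable {m n : ℕ}

theorem finite_det_add_smul_one (A : Matrix (Fin m) (Fin m) ℂ) :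
    {t : ℂ | (A + t • (1 : Matrix (Fin m) (Fin m) ℂ)).det = 0}.Finite := by
  refine (Polynomial.finite_setOfPred_isRoot (charpoly_monic (-A)).ne_zero).subset fun t ht => ?_
  rw [Set.mem_ofPred_eq, Polynomial.IsRoot.def, eval_charpoly, sub_neg_eq_add, add_comm]
  simpa [Matrix.smul_one_eq_diagonal] using ht

/-- Every matrix `X` admits a matrix `Y` of full rank with `(X, Y)` in `E`. -/
theorem exists_fullRank_right (hmn : m ≤ n) (X : Matrix (Fin m) (Fin n) ℂ) :
    ∃ Y : Matrix (Fin n) (Fin m) ℂ, (X * Y).IsLowerTriangular ∧ (Y * X).IsUpperTriangular ∧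
      ∃ Z : Matrix (Fin m) (Fin n) ℂ, Z * Y = 1 := by
  obtain ⟨b, π, ε, N, hN, -, -, hX⟩ := exists_bruhat hmn X
  obtain ⟨c, hc⟩ := BPlus.exists_coe_eq (unipotent π N) (unipotent_upper hN)
    fun i => by simp [unipotent_diag hN]
  set P : Matrix (Fin m) (Fin n) ℂ := injMatrix ℂ π
  have hPP : P * Pᵀ = 1 := injMatrix_mul_transpose π
  rw [← hc] at hX
  refine ⟨(c⁻¹ : BPlus n).1.1 * Pᵀ * (b⁻¹ : BMinus m).1.1, ?_, ?_, b.1.1 * P * c.1.1, ?_⟩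
  · have e : X * ((c⁻¹ : BPlus n).1.1 * Pᵀ * (b⁻¹ : BMinus m).1.1) =
        b.1.1 * diagonal ε * (b⁻¹ : BMinus m).1.1 := by
      calc _ = b.1.1 * diagonal ε * (P * ((c.1.1 * (c⁻¹ : BPlus n).1.1) * Pᵀ)) *
            (b⁻¹ : BMinus m).1.1 := by rw [hX]; simp only [Matrix.mul_assoc]
        _ = _ := by rw [BPlus.mul_inv, Matrix.one_mul, hPP, Matrix.mul_one]
    rw [e]
    exact (BlockTriangular.mul b.2 (blockTriangular_diagonal ε)).mul (b⁻¹).2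
  · have e : (c⁻¹ : BPlus n).1.1 * Pᵀ * (b⁻¹ : BMinus m).1.1 * X =
        (c⁻¹ : BPlus n).1.1 * (Pᵀ * diagonal ε * P) * c.1.1 := by
      calc _ = (c⁻¹ : BPlus n).1.1 * Pᵀ * ((b⁻¹ : BMinus m).1.1 * b.1.1) * diagonal ε * P *
            c.1.1 := by rw [hX]; simp only [Matrix.mul_assoc]
        _ = _ := by rw [BMinus.inv_mul, Matrix.mul_one]; simp only [Matrix.mul_assoc]
    rw [e]
    refine (BlockTriangular.mul (c⁻¹).2 ?_).mul c.2
    intro i j hij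
    have hne : i ≠ j := ne_of_gt hij
    rw [Matrix.mul_apply]
    refine Finset.sum_eq_zero fun k _ => ?_
    by_cases h1 : π k = i
    · have h2 : π k ≠ j := fun h => hne (h1.symm.trans h)
      simp [P, injMatrix, h2]
    · simp [P, injMatrix, h1]
  · calc _ = b.1.1 * (P * ((c.1.1 * (c⁻¹ : BPlus n).1.1) * Pᵀ)) * (b⁻¹ : BMinus m).1.1 := by
          simp only [Matrix.mul_assoc]
      _ = _ := by rw [BPlus.mul_inv, Matrix.one_mul, hPP, Matrix.mul_one, BMinus.mul_inv]

/-- Every matrix `Y` admits a matrix `X` of full rank with `(X, Y)` in `E`: transposing and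
reversing the order of rows and columns exchanges the roles of `X` and `Y`. -/
theorem exists_fullRank_left (hmn : m ≤ n) (Y : Matrix (Fin n) (Fin m) ℂ) :
    ∃ X : Matrix (Fin m) (Fin n) ℂ, (X * Y).IsLowerTriangular ∧ (Y * X).IsUpperTriangular ∧
      ∃ Z : Matrix (Fin n) (Fin m) ℂ, X * Z = 1 := by
  obtain ⟨Y', h1, h2, Z, hZ⟩ := exists_fullRank_right hmn (Yᵀ.submatrix Fin.revPerm Fin.revPerm)
  have e1 : (Y'ᵀ.submatrix Fin.revPerm Fin.revPerm) * Y =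
      (((Yᵀ.submatrix Fin.revPerm Fin.revPerm) * Y')ᵀ).submatrix Fin.revPerm Fin.revPerm := by
    rw [Matrix.transpose_mul, Matrix.submatrix_mul_equiv _ _ _ Fin.revPerm _ |>.symm]
    congr 1
    ext i j
    simp
  have e2 : Y * (Y'ᵀ.submatrix Fin.revPerm Fin.revPerm) =
      ((Y' * (Yᵀ.submatrix Fin.revPerm Fin.revPerm))ᵀ).submatrix Fin.revPerm Fin.revPerm := by
    rw [Matrix.transpose_mul, Matrix.submatrix_mul_equiv _ _ _ Fin.revPerm _ |>.symm]
    congr 1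
    ext i j
    simp
  refine ⟨Y'ᵀ.submatrix Fin.revPerm Fin.revPerm, ?_, ?_, Zᵀ.submatrix Fin.revPerm Fin.revPerm, ?_⟩
  · rw [e1]
    intro i j hij
    exact h1 (i := Fin.rev j) (j := Fin.rev i) (Fin.rev_lt_rev.mpr hij)
  · rw [e2]
    intro i j hij
    exact h2 (i := Fin.rev j) (j := Fin.rev i) (Fin.rev_lt_rev.mpr hij)
  · rw [Matrix.submatrix_mul_equiv, ← Matrix.transpose_mul, hZ]
    simp

/-- Every pair is a limit of pairs with the same `Y` whose `X` has a right inverse. -/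
theorem toPoint_mem_closure_fullRank (hmn : m ≤ n) (p : LUPair m n) :
    p.toPoint ∈ closure (LUPair.toPoint ''
      {q : LUPair m n | ∃ Z : Matrix (Fin n) (Fin m) ℂ, q.X * Z = 1}) := by
  obtain ⟨X, hl, hu, Z, hZ⟩ := exists_fullRank_left hmn p.Y
  let q : ℂ → LUPair m n := fun t => ⟨p.X + t • X, p.Y, by
    rw [Matrix.add_mul, Matrix.smul_mul]
    exact p.lower.add fun i j hij => by simp [hl hij], by
    rw [Matrix.mul_add, Matrix.mul_smul]
    exact p.upper.add fun i j hij => by simp [hu hij]⟩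
  have hq0 : q 0 = p := LUPair.ext' (by simp [q]) rfl
  rw [← hq0]
  refine toPoint_mem_closure_of_line q p.X X p.Y 0 (fun t => rfl) (fun t => by simp [q])
    (finite_det_add_smul_one (p.X * Z)) fun t ht => subset_closure ⟨q t, ?_, rfl⟩
  have e : (p.X + t • X) * Z = p.X * Z + t • (1 : Matrix (Fin m) (Fin m) ℂ) := by
    rw [Matrix.add_mul, Matrix.smul_mul, hZ]
  rw [Set.mem_ofPred_eq, ← e] at ht
  exact ⟨Z * ((p.X + t • X) * Z)⁻¹, by
    rw [← Matrix.mul_assoc, mul_nonsing_inv _ (isUnit_iff_ne_zero.mpr ht)]⟩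

end FullRank

/-! ### The generic pairs and the covering by the `E_π` -/

section Generic

variable {m n : ℕ}

/-- The set of complex points whose closure is `E_π`. -/
def genericSet (π : Fin m ↪ Fin n) : Set (LUPair m n) :=
  {p | (∀ i, (p.Y * p.X) (π i) (π i) = (p.X * p.Y) i i) ∧
    (Function.Injective fun i => (p.X * p.Y) i i) ∧ ∀ i, (p.X * p.Y) i i ≠ 0}

theorem luComponent_eq (π : Fin m ↪ Fin n) :
    luComponent π = closure (LUPair.toPoint '' genericSet π) := rfl

theorem act_X_mul_Y (b : BMinus m) (c : BPlus n) (p : LUPair m n) :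
    (act b c p).X * (act b c p).Y = b.1.1 * (p.X * p.Y) * (b⁻¹ : BMinus m).1.1 := by
  calc _ = b.1.1 * p.X * ((c⁻¹ : BPlus n).1.1 * c.1.1) * p.Y * (b⁻¹ : BMinus m).1.1 := by
        simp only [act, Matrix.mul_assoc]
    _ = _ := by rw [BPlus.inv_mul]; simp only [Matrix.mul_assoc, Matrix.mul_one]

theorem act_Y_mul_X (b : BMinus m) (c : BPlus n) (p : LUPair m n) :
    (act b c p).Y * (act b c p).X = c.1.1 * (p.Y * p.X) * (c⁻¹ : BPlus n).1.1 := by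
  calc _ = c.1.1 * p.Y * ((b⁻¹ : BMinus m).1.1 * b.1.1) * p.X * (c⁻¹ : BPlus n).1.1 := by
        simp only [act, Matrix.mul_assoc]
    _ = _ := by rw [BMinus.inv_mul]; simp only [Matrix.mul_assoc, Matrix.mul_one]

theorem act_X_mul_Y_diag (b : BMinus m) (c : BPlus n) (p : LUPair m n) (i : Fin m) :
    ((act b c p).X * (act b c p).Y) i i = (p.X * p.Y) i i := by
  rw [act_X_mul_Y]
  exact lower_conj_diag b.2 p.lower (b⁻¹).2 (BMinus.mul_inv b) i

theorem act_Y_mul_X_diag (b : BMinus m) (c : BPlus n) (p : LUPair m n) (j : Fin n) :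
    ((act b c p).Y * (act b c p).X) j j = (p.Y * p.X) j j := by
  rw [act_Y_mul_X]
  exact upper_conj_diag c.2 p.upper (c⁻¹).2 (BPlus.mul_inv c) j

theorem act_mem_genericSet {π : Fin m ↪ Fin n} {p : LUPair m n} (b : BMinus m) (c : BPlus n)
    (hp : p ∈ genericSet π) : act b c p ∈ genericSet π := by
  simpa only [genericSet, Set.mem_ofPred_eq, act_X_mul_Y_diag, act_Y_mul_X_diag] using hp

theorem act_act (b b' : BMinus m) (c c' : BPlus n) (p : LUPair m n) :
    act b c (act b' c' p) = act (b * b') (c * c') p := by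
  refine LUPair.ext' ?_ ?_ <;> simp [act, Matrix.mul_assoc]

theorem act_one (p : LUPair m n) : act 1 1 p = p := by
  refine LUPair.ext' ?_ ?_ <;> simp [act]

/-- Adding `t • (0, πᵀ s)` to a pair `(π, Y)` moves it into the generic locus for almost all `t`. -/
theorem act_toPoint_mem_luComponent (π : Fin m ↪ Fin n) (b : BMinus m) (c : BPlus n)
    (p : LUPair m n) (hp : p.X = permMat π) : (act b c p).toPoint ∈ luComponent π := by
  set s : Fin m → ℂ := fun i => (i : ℂ) + 1 with hs
  have hs0 : ∀ i, s i ≠ 0 := fun i => Nat.cast_add_one_ne_zero i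
  have hsinj : ∀ i j, i ≠ j → s i - s j ≠ 0 := by
    intro i j hij h
    apply hij
    simpa [hs, sub_eq_zero, Fin.ext_iff] using h
  set Y := (basePair π s).Y with hY
  have hl := (basePair π s).lower
  have hu := (basePair π s).upper
  have hbX : (basePair π s).X = p.X := hp.symm
  rw [hbX, ← hY] at hl hu
  let q : ℂ → LUPair m n := fun t => ⟨p.X, p.Y + t • Y, by
    rw [Matrix.mul_add, Matrix.mul_smul]
    exact p.lower.add fun i j hij => by simp [hl hij], by
    rw [Matrix.add_mul, Matrix.smul_mul]
    exact p.upper.add fun i j hij => by simp [hu hij]⟩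
  have hq0 : act b c (q 0) = act b c p := congrArg _ (LUPair.ext' rfl (by simp [q]))
  have hXY : ∀ t i, ((q t).X * (q t).Y) i i = p.Y (π i) i + t * s i := by
    intro t i
    simp only [q, hp, permMat_eq_injMatrix, injMatrix_mul_apply, Matrix.add_apply,
      Matrix.smul_apply, smul_eq_mul]
    rw [show Y = (injMatrix ℂ π)ᵀ * diagonal s from rfl, injMatrix_transpose_mul_apply,
      diagonal_apply_eq]
  have hYX : ∀ t i, ((q t).Y * (q t).X) (π i) (π i) = p.Y (π i) i + t * s i := by
    intro t i
    rw [← hXY]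
    simp only [q, hp, permMat_eq_injMatrix, injMatrix_mul_apply, mul_injMatrix_apply]
  have hlin : ∀ a b : ℂ, b ≠ 0 → {t : ℂ | a + t * b = 0}.Finite := by
    intro a b hb
    refine (Set.finite_singleton (-a / b)).subset fun t ht => ?_
    rw [Set.mem_ofPred_eq] at ht
    rw [Set.mem_singleton_iff, eq_div_iff hb]
    linear_combination ht
  rw [← hq0]
  refine toPoint_mem_closure_of_line (fun t => act b c (q t)) (act b c p).X 0 (act b c p).Y
    (c.1.1 * Y * (b⁻¹ : BMinus m).1.1) (fun t => by simp [q, act])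
    (fun t => by simp [q, act, Matrix.mul_add, Matrix.add_mul])
    (B := (⋃ i, {t | p.Y (π i) i + t * s i = 0}) ∪ ⋃ i, ⋃ j, ⋃ _ : i ≠ j,
      {t | (p.Y (π i) i - p.Y (π j) j) + t * (s i - s j) = 0})
    (Set.Finite.union (Set.finite_iUnion fun i => hlin _ _ (hs0 i)) (Set.finite_iUnion fun i =>
      Set.finite_iUnion fun j => Set.finite_iUnion fun h => hlin _ _ (hsinj i j h)))
    fun t ht => subset_closure ⟨_, act_mem_genericSet b c ⟨?_, ?_, ?_⟩, rfl⟩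
  · intro i
    rw [hYX, hXY]
  · intro i j hij
    dsimp only at hij
    rw [hXY, hXY] at hij
    by_contra hne
    apply ht
    refine Or.inr (Set.mem_iUnion.mpr ⟨i, Set.mem_iUnion.mpr ⟨j, Set.mem_iUnion.mpr ⟨hne, ?_⟩⟩⟩)
    rw [Set.mem_ofPred_eq]
    linear_combination hij
  · intro i h
    rw [hXY] at h
    exact ht (Or.inl (Set.mem_iUnion.mpr ⟨i, h⟩))

theorem toPoint_mem_luComponent {π : Fin m ↪ Fin n} (p : LUPair m n) (b : BMinus m) (c : BPlus n)
    (hp : p.X = b.1.1 * (permMat π * c.1.1)) : p.toPoint ∈ luComponent π := by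
  have e : p = act b c⁻¹ (act b⁻¹ c p) := by
    rw [act_act, mul_inv_cancel, inv_mul_cancel, act_one]
  rw [e]
  refine act_toPoint_mem_luComponent π _ _ _ ?_
  calc (b⁻¹ : BMinus m).1.1 * p.X * (c⁻¹ : BPlus n).1.1
      = ((b⁻¹ : BMinus m).1.1 * b.1.1) * permMat π * (c.1.1 * (c⁻¹ : BPlus n).1.1) := by
        rw [hp]; simp only [Matrix.mul_assoc]
    _ = permMat π := by rw [BMinus.inv_mul, BPlus.mul_inv, Matrix.one_mul, Matrix.mul_one]

theorem toPoint_mem_iUnion_luComponent (hmn : m ≤ n) (p : LUPair m n) (Z : Matrix (Fin n) (Fin m) ℂ)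
    (hZ : p.X * Z = 1) : p.toPoint ∈ ⋃ π : Fin m ↪ Fin n, luComponent π := by
  obtain ⟨b, π, N, hN, -, hX⟩ := exists_bruhat_of_mul_eq_one hmn p.X Z hZ
  obtain ⟨c, hc⟩ := BPlus.exists_coe_eq (unipotent π N) (unipotent_upper hN)
    fun i => by simp [unipotent_diag hN]
  exact Set.mem_iUnion.mpr ⟨π, toPoint_mem_luComponent p b c (by rw [hX, hc]; rfl)⟩

theorem iUnion_luComponent (hmn : m ≤ n) :
    ⋃ π : Fin m ↪ Fin n, luComponent π = Set.univ := by
  rw [← Set.univ_subset_iff, ← closure_range_toPoint]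
  have hclosed : IsClosed (⋃ π : Fin m ↪ Fin n, luComponent π) :=
    isClosed_iUnion_of_finite fun π => isClosed_closure
  refine closure_minimal ?_ hclosed
  rintro _ ⟨p, -, rfl⟩
  refine closure_minimal ?_ hclosed (toPoint_mem_closure_fullRank hmn p)
  rintro _ ⟨q, ⟨Z, hZ⟩, rfl⟩
  exact toPoint_mem_iUnion_luComponent hmn q Z hZ

end Generic

/-! ### Diagonalization of generic pairs -/

section Orbit

variable {m n : ℕ}

theorem toPoint_orbitSet_subset (π : Fin m ↪ Fin n) :
    LUPair.toPoint '' orbitSet π ⊆ luComponent π := by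
  rintro _ ⟨_, ⟨b, c, s, rfl⟩, rfl⟩
  exact act_toPoint_mem_luComponent π b c _ rfl

theorem charpoly_of_isLowerTriangular {A : Matrix (Fin m) (Fin m) ℂ} (hA : A.IsLowerTriangular) :
    A.charpoly = ∏ i, (Polynomial.X - Polynomial.C (A i i)) := by
  rw [← charpoly_transpose, charpoly_of_isUpperTriangular Aᵀ fun i j hij => hA hij]
  rfl

/-- Comparing the characteristic polynomials of `XY` and `YX`. -/
theorem genericSet_diag_eq_zero (hmn : m ≤ n) {π : Fin m ↪ Fin n} {p : LUPair m n}
    (hp : p ∈ genericSet π) {j : Fin n} (hj : ∀ i, π i ≠ j) : (p.Y * p.X) j j = 0 := by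
  have h := charpoly_mul_comm_of_le p.Y p.X (by simpa using hmn)
  have hXY := charpoly_of_isLowerTriangular p.lower
  -- cancelling the factors of the `XY`-side leaves `∏_{j ∉ im π} (T - (YX)_{jj}) = T ^ (n - m)`
  rw [hXY, charpoly_of_isUpperTriangular _ p.upper,
    ← Finset.prod_mul_prod_compl (Finset.univ.map π), Finset.prod_map, mul_comm] at h
  simp only [hp.1] at h
  have hne : (∏ i, (Polynomial.X - Polynomial.C ((p.X * p.Y) i i))) ≠ 0 :=
    (Polynomial.monic_prod_of_monic _ _ fun i _ => Polynomial.monic_X_sub_C _).ne_zero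
  have h' := congrArg (Polynomial.eval ((p.Y * p.X) j j)) (mul_right_cancel₀ hne h)
  rw [Polynomial.eval_prod, Finset.prod_eq_zero (i := j) (by simpa using hj) (by simp)] at h'
  simp only [Polynomial.eval_pow, Polynomial.eval_X] at h'
  exact eq_zero_of_pow_eq_zero h'.symm

theorem aeval_apply_self {k : ℕ} (S : Subalgebra ℂ (Matrix (Fin k) (Fin k) ℂ)) (i : Fin k)
    (hS : ∀ A ∈ S, ∀ B ∈ S, (A * B) i i = A i i * B i i) {A : Matrix (Fin k) (Fin k) ℂ}
    (hA : A ∈ S) (f : Polynomial ℂ) : (Polynomial.aeval A f) i i = f.eval (A i i) := by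
  have hpow : ∀ e : ℕ, (A ^ e) i i = A i i ^ e := by
    intro e
    induction e with
    | zero => simp
    | succ e ih => rw [pow_succ, pow_succ, hS _ (S.pow_mem hA e) _ hA, ih]
  induction f using Polynomial.induction_on' with
  | add f g hf hg => rw [map_add, Matrix.add_apply, hf, hg, Polynomial.eval_add]
  | monomial e a =>
    rw [Polynomial.aeval_monomial, ← Algebra.smul_def, Matrix.smul_apply, hpow,
      Polynomial.eval_monomial, smul_eq_mul]

theorem aeval_mul_swap (A : Matrix (Fin m) (Fin n) ℂ) (B : Matrix (Fin n) (Fin m) ℂ)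
    (f : Polynomial ℂ) :
    Polynomial.aeval (B * A) f * B = B * Polynomial.aeval (A * B) f := by
  have hpow : ∀ e : ℕ, (B * A) ^ e * B = B * (A * B) ^ e := by
    intro e
    induction e with
    | zero => simp
    | succ e ih =>
      rw [pow_succ', pow_succ', Matrix.mul_assoc, ih]
      simp only [Matrix.mul_assoc]
  induction f using Polynomial.induction_on' with
  | add f g hf hg => rw [map_add, map_add, Matrix.add_mul, Matrix.mul_add, hf, hg]
  | monomial e a =>
    rw [Polynomial.aeval_monomial, Polynomial.aeval_monomial, ← Algebra.smul_def,
      ← Algebra.smul_def, Matrix.smul_mul, Matrix.mul_smul, hpow]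

theorem aeval_mem_subalgebra {k : ℕ} {S : Subalgebra ℂ (Matrix (Fin k) (Fin k) ℂ)}
    {A : Matrix (Fin k) (Fin k) ℂ} (hA : A ∈ S) (f : Polynomial ℂ) : Polynomial.aeval A f ∈ S :=
  Algebra.adjoin_le (Set.singleton_subset_iff.mpr hA) (Polynomial.aeval_mem_adjoin_singleton ℂ A)

/-- The rows of `b` are left eigenvectors of `XY`, those of `c` are left eigenvectors of `YX`;
they are rows of suitable polynomials in `XY` and `YX`, hence `b` and `c` are triangular. -/
theorem exists_act_diagonal (hmn : m ≤ n) {π : Fin m ↪ Fin n} {p : LUPair m n}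
    (hp : p ∈ genericSet π) : ∃ (b : BMinus m) (c : BPlus n),
      (act b c p).X * (act b c p).Y = diagonal (fun i => (p.X * p.Y) i i) ∧
      (act b c p).Y * (act b c p).X = diagonal (fun j => (p.Y * p.X) j j) := by
  obtain ⟨h1, h2, h3⟩ := id hp
  set A := p.X * p.Y with hA
  set D := p.Y * p.X with hD
  set r : Polynomial ℂ := ∏ i, (Polynomial.X - Polynomial.C (A i i)) with hr
  have hrA : Polynomial.aeval A r = 0 := by
    rw [hr, ← charpoly_of_isLowerTriangular p.lower]
    exact aeval_self_charpoly A
  have hsub : ∀ i k, k ≠ i → A i i - A k k ≠ 0 := fun i k hk h =>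
    hk (h2 (sub_eq_zero.mp h)).symm
  -- `f i` vanishes at all eigenvalues of `XY` except the `i`-th one
  set f : Fin m → Polynomial ℂ := fun i =>
    ∏ k ∈ Finset.univ.erase i, (Polynomial.X - Polynomial.C (A k k)) with hf
  have hfr : ∀ i, f i * (Polynomial.X - Polynomial.C (A i i)) = r := fun i =>
    Finset.prod_erase_mul _ _ (Finset.mem_univ i)
  have hfe : ∀ i, (f i).eval (A i i) ≠ 0 := by
    intro i
    rw [hf, Polynomial.eval_prod, Finset.prod_ne_zero_iff]
    intro k hk
    simpa using hsub i k (Finset.ne_of_mem_erase hk)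
  -- `YX` is annihilated by `r * T`, and `g j` plays the role of `f i` for `YX`; the eigenvalue `0`
  -- of `YX` may be multiple, but it is a simple root of `r * T`
  have hg : ∀ j, ∃ g : Polynomial ℂ,
      g * (Polynomial.X - Polynomial.C (D j j)) = r * Polynomial.X ∧ g.eval (D j j) ≠ 0 := by
    intro j
    by_cases hj : ∃ i, π i = j
    · obtain ⟨i, rfl⟩ := hj
      refine ⟨f i * Polynomial.X, ?_, ?_⟩
      · rw [h1, ← hfr i]; ring
      · rw [h1, Polynomial.eval_mul, Polynomial.eval_X]
        exact mul_ne_zero (hfe i) (h3 i)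
    · push Not at hj
      have h0 : D j j = 0 := genericSet_diag_eq_zero hmn hp hj
      refine ⟨r, by rw [h0]; simp, ?_⟩
      rw [h0, hr, Polynomial.eval_prod, Finset.prod_ne_zero_iff]
      intro k _
      simpa using h3 k
  choose g hgr hge using hg
  have hDr : Polynomial.aeval D (r * Polynomial.X) = 0 := by
    rw [map_mul, Polynomial.aeval_X]
    nth_rewrite 2 [hD]
    rw [← Matrix.mul_assoc, aeval_mul_swap, hrA, Matrix.mul_zero, Matrix.zero_mul]
  have hrow : ∀ {k : ℕ} (M : Matrix (Fin k) (Fin k) ℂ) (u : Polynomial ℂ) (z : ℂ),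
      Polynomial.aeval M (u * (Polynomial.X - Polynomial.C z)) = 0 →
      Polynomial.aeval M u * M = z • Polynomial.aeval M u := by
    intro k M u z h
    rw [mul_sub, map_sub, map_mul, map_mul, Polynomial.aeval_X, Polynomial.aeval_C,
      sub_eq_zero] at h
    rw [h, ← Algebra.commutes, ← Algebra.smul_def]
  obtain ⟨b, hb⟩ := BMinus.exists_coe_eq
    (Matrix.of fun i l => (Polynomial.aeval A (f i)) i l)
    (fun i l hil => aeval_mem_subalgebra
      (S := blockTriangularSubalgebra ℂ ℂ (OrderDual.toDual : Fin m → (Fin m)ᵒᵈ)) p.lower (f i) hil)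
    (fun i => by
      rw [Matrix.of_apply, aeval_apply_self
        (blockTriangularSubalgebra ℂ ℂ (OrderDual.toDual : Fin m → (Fin m)ᵒᵈ)) i
        (fun A hA B hB => lower_mul_diag hA hB i) p.lower]
      exact hfe i)
  obtain ⟨c, hc⟩ := BPlus.exists_coe_eq
    (Matrix.of fun j l => (Polynomial.aeval D (g j)) j l)
    (fun j l hjl => aeval_mem_subalgebra
      (S := blockTriangularSubalgebra ℂ ℂ id) p.upper (g j) hjl)
    (fun j => by
      rw [Matrix.of_apply, aeval_apply_self (blockTriangularSubalgebra ℂ ℂ id) j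
        (fun A hA B hB => upper_mul_diag hA hB j) p.upper]
      exact hge j)
  refine ⟨b, c, ?_, ?_⟩
  · have e : b.1.1 * A = diagonal (fun i => A i i) * b.1.1 := by
      ext i l
      have := congrFun (congrFun (hrow A (f i) (A i i) (by rw [hfr, hrA])) i) l
      rw [diagonal_mul, hb, Matrix.of_apply]
      simpa [Matrix.mul_apply] using this
    rw [act_X_mul_Y, ← hA, e, Matrix.mul_assoc, BMinus.mul_inv, Matrix.mul_one]
  · have e : c.1.1 * D = diagonal (fun j => D j j) * c.1.1 := by
      ext j l
      have := congrFun (congrFun (hrow D (g j) (D j j) (by rw [hgr, hDr])) j) l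
      rw [diagonal_mul, hc, Matrix.of_apply]
      simpa [Matrix.mul_apply] using this
    rw [act_Y_mul_X, ← hD, e, Matrix.mul_assoc, BPlus.mul_inv, Matrix.mul_one]

theorem genericSet_subset_orbitSet (hmn : m ≤ n) (π : Fin m ↪ Fin n) :
    genericSet π ⊆ orbitSet π := by
  intro p hp
  obtain ⟨b, c, hXY, hYX⟩ := exists_act_diagonal hmn hp
  set q := act b c p
  set s : Fin m → ℂ := fun i => (p.X * p.Y) i i
  set d : Fin n → ℂ := fun j => (p.Y * p.X) j j
  have hsd : ∀ i j, π i ≠ j → d j ≠ s i := by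
    intro i j hij h
    by_cases hj : ∃ k, π k = j
    · obtain ⟨k, rfl⟩ := hj
      have : s k = s i := (hp.1 k).symm.trans h
      exact hij (congrArg π (hp.2.1 this).symm)
    · push Not at hj
      exact hp.2.2 i (h.symm.trans (genericSet_diag_eq_zero hmn hp hj))
  -- `X` and `Y` intertwine the diagonal matrices `XY` and `YX`, hence are supported on `π`
  have hX0 : ∀ i j, π i ≠ j → q.X i j = 0 := by
    intro i j hij
    have e : q.X * diagonal d = diagonal s * q.X := by
      rw [← hXY, ← hYX, Matrix.mul_assoc]
    have := congrFun (congrFun e i) j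
    rw [mul_diagonal, diagonal_mul] at this
    exact (mul_eq_zero.mp (show (d j - s i) * q.X i j = 0 by linear_combination this)).resolve_left
      (sub_ne_zero.mpr (hsd i j hij))
  have hY0 : ∀ i j, π i ≠ j → q.Y j i = 0 := by
    intro i j hij
    have e : q.Y * diagonal s = diagonal d * q.Y := by
      rw [← hXY, ← hYX, Matrix.mul_assoc]
    have := congrFun (congrFun e j) i
    rw [mul_diagonal, diagonal_mul] at this
    exact (mul_eq_zero.mp (show (d j - s i) * q.Y j i = 0 by linear_combination -this)).resolve_left
      (sub_ne_zero.mpr (hsd i j hij))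
  have hts : ∀ i, q.X i (π i) * q.Y (π i) i = s i := by
    intro i
    have := congrFun (congrFun hXY i) i
    rw [Matrix.mul_apply, diagonal_apply_eq,
      Finset.sum_eq_single (π i) (fun j _ hj => by rw [hX0 i j hj.symm, zero_mul])
        (by simp)] at this
    exact this
  have ht : ∀ i, q.X i (π i) ≠ 0 := fun i h => hp.2.2 i (by
    rw [← show q.X i (π i) * q.Y (π i) i = (p.X * p.Y) i i from hts i, h, zero_mul])
  obtain ⟨t, htt⟩ := BMinus.exists_coe_eq (diagonal fun i => q.X i (π i))
    (blockTriangular_diagonal _) (fun i => by simpa using ht i)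
  have hq : q = act t 1 (basePair π s) := by
    refine LUPair.ext' ?_ ?_
    · ext i j
      simp only [act, basePair, htt, inv_one, Subgroup.coe_one, Units.val_one, Matrix.mul_one,
        diagonal_mul, permMat, Matrix.of_apply]
      by_cases h : π i = j
      · simp [← h]
      · simp [h, hX0 i j h]
    · have e : q.Y * t.1.1 = (permMat π)ᵀ * diagonal s := by
        ext j i
        rw [htt, mul_diagonal, mul_diagonal]
        by_cases h : π i = j
        · simp [← h, permMat, ← hts i, mul_comm]
        · simp [h, hY0 i j h, permMat]
      simp only [act, basePair, Subgroup.coe_one, Units.val_one, Matrix.one_mul]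
      rw [← e, Matrix.mul_assoc, BMinus.mul_inv, Matrix.mul_one]
  refine ⟨b⁻¹ * t, c⁻¹ * 1, s, ?_⟩
  rw [← act_act, ← hq, act_act, inv_mul_cancel, inv_mul_cancel, act_one]

theorem luComponent_eq_closure_orbitSet (hmn : m ≤ n) (π : Fin m ↪ Fin n) :
    luComponent π = closure (LUPair.toPoint '' orbitSet π) :=
  Set.Subset.antisymm (closure_mono (Set.image_mono (genericSet_subset_orbitSet hmn π)))
    (closure_minimal (toPoint_orbitSet_subset π) isClosed_closure)

end Orbit

/-! ### The `E_π` are pairwise incomparable -/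

section Distinct

variable {m n : ℕ}

theorem evalAmbient_X_mul_Y (p : LUPair m n) (i i' : Fin m) :
    p.evalAmbient ((genX m n * genY m n) i i') = (p.X * p.Y) i i' := by
  simp [Matrix.mul_apply, genX, genY, LUPair.evalAmbient]

theorem evalAmbient_Y_mul_X (p : LUPair m n) (j j' : Fin n) :
    p.evalAmbient ((genY m n * genX m n) j j') = (p.Y * p.X) j j' := by
  simp [Matrix.mul_apply, genX, genY, LUPair.evalAmbient]

/-- A generic pair determines its injection. -/
theorem eq_of_mem_genericSet (hmn : m ≤ n) {π ρ : Fin m ↪ Fin n} {p : LUPair m n}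
    (hp : p ∈ genericSet π) (h : ∀ i, (p.Y * p.X) (ρ i) (ρ i) = (p.X * p.Y) i i) : π = ρ := by
  refine DFunLike.ext _ _ fun i => ?_
  by_cases hi : ∃ k, π k = ρ i
  · obtain ⟨k, hk⟩ := hi
    have h1 := h i
    rw [← hk, hp.1 k] at h1
    obtain rfl : k = i := hp.2.1 h1
    exact hk
  · push Not at hi
    exact absurd ((h i).symm.trans (genericSet_diag_eq_zero hmn hp hi)) (hp.2.2 i)

theorem diag_eq_of_toPoint_mem_luComponent {ρ : Fin m ↪ Fin n} {p : LUPair m n}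
    (hp : p.toPoint ∈ luComponent ρ) (i : Fin m) :
    (p.Y * p.X) (ρ i) (ρ i) = (p.X * p.Y) i i := by
  have := toPoint_mem_closure_iff.mp hp
    ((genY m n * genX m n) (ρ i) (ρ i) - (genX m n * genY m n) i i) fun q hq => by
      rw [map_sub, evalAmbient_X_mul_Y, evalAmbient_Y_mul_X, hq.1 i, sub_self]
  rwa [map_sub, evalAmbient_X_mul_Y, evalAmbient_Y_mul_X, sub_eq_zero] at this

theorem genericSet_nonempty (π : Fin m ↪ Fin n) : (genericSet π).Nonempty := by
  have h := toPoint_orbitSet_subset π ⟨_, ⟨1, 1, 0, rfl⟩, rfl⟩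
  rw [luComponent_eq] at h
  exact Set.image_nonempty.mp (closure_nonempty_iff.mp ⟨_, h⟩)

theorem eq_of_luComponent_subset (hmn : m ≤ n) {π ρ : Fin m ↪ Fin n}
    (h : luComponent π ⊆ luComponent ρ) : π = ρ := by
  obtain ⟨p, hp⟩ := genericSet_nonempty π
  exact eq_of_mem_genericSet hmn hp
    (diag_eq_of_toPoint_mem_luComponent (h (subset_closure ⟨p, hp, rfl⟩)))

end Distinct

/-! ### The projections -/

section Projections

variable {m n : ℕ}

theorem projX_toPoint (p : LUPair m n) : projX m n p.toPoint = matPoint p.X := by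
  refine PrimeSpectrum.ext (Ideal.ext fun f => ?_)
  change p.evalAmbient (rename Sum.inl f) = 0 ↔ eval _ f = 0
  rw [LUPair.evalAmbient, eval_rename]
  rfl

theorem projY_toPoint (p : LUPair m n) : projY m n p.toPoint = matPoint p.Y := by
  refine PrimeSpectrum.ext (Ideal.ext fun f => ?_)
  change p.evalAmbient (rename Sum.inr f) = 0 ↔ eval _ f = 0
  rw [LUPair.evalAmbient, eval_rename]
  rfl

/-- The comorphism of the section `X ↦ (X, 0)` of the first projection. -/
def sectionXHom (m n : ℕ) : luRing m n →+* MvPolynomial (Fin m × Fin n) ℂ :=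
  Ideal.Quotient.lift (luIdeal m n) (aeval (R := ℂ) (Sum.elim X fun _ => 0)).toRingHom (by
    have h : luIdeal m n ≤ RingHom.ker (aeval (R := ℂ) (Sum.elim X fun _ => 0) :
        MvPolynomial (Vars m n) ℂ →ₐ[ℂ] MvPolynomial (Fin m × Fin n) ℂ).toRingHom := by
      rw [luIdeal, Ideal.span_le]
      rintro _ (⟨i, i', hi, rfl⟩ | ⟨j, j', hj, rfl⟩) <;>
        simp [RingHom.mem_ker, Matrix.mul_apply, genX, genY]
    exact fun f hf => h hf)

/-- The comorphism of the section `Y ↦ (0, Y)` of the second projection. -/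
def sectionYHom (m n : ℕ) : luRing m n →+* MvPolynomial (Fin n × Fin m) ℂ :=
  Ideal.Quotient.lift (luIdeal m n) (aeval (R := ℂ) (Sum.elim (fun _ => 0) X)).toRingHom (by
    have h : luIdeal m n ≤ RingHom.ker (aeval (R := ℂ) (Sum.elim (fun _ => 0) X) :
        MvPolynomial (Vars m n) ℂ →ₐ[ℂ] MvPolynomial (Fin n × Fin m) ℂ).toRingHom := by
      rw [luIdeal, Ideal.span_le]
      rintro _ (⟨i, i', hi, rfl⟩ | ⟨j, j', hj, rfl⟩) <;>
        simp [RingHom.mem_ker, Matrix.mul_apply, genX, genY]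
    exact fun f hf => h hf)

/-- The section `X ↦ (X, 0)` of the first projection. -/
def sectionX (m n : ℕ) : matSpace m n ⟶ luScheme m n :=
  Spec.map (CommRingCat.ofHom (sectionXHom m n))

/-- The section `Y ↦ (0, Y)` of the second projection. -/
def sectionY (m n : ℕ) : matSpace n m ⟶ luScheme m n :=
  Spec.map (CommRingCat.ofHom (sectionYHom m n))

theorem projX_sectionX (x : matSpace m n) : projX m n (sectionX m n x) = x := by
  change PrimeSpectrum (MvPolynomial (Fin m × Fin n) ℂ) at x
  refine PrimeSpectrum.ext (Ideal.ext fun f => ?_)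
  change (aeval (R := ℂ) (Sum.elim X fun _ => 0) (rename Sum.inl f) :
    MvPolynomial (Fin m × Fin n) ℂ) ∈ x.asIdeal ↔ f ∈ x.asIdeal
  rw [aeval_rename, Sum.elim_comp_inl, aeval_X_left_apply]

theorem projY_sectionY (y : matSpace n m) : projY m n (sectionY m n y) = y := by
  change PrimeSpectrum (MvPolynomial (Fin n × Fin m) ℂ) at y
  refine PrimeSpectrum.ext (Ideal.ext fun f => ?_)
  change (aeval (R := ℂ) (Sum.elim (fun _ => 0) X) (rename Sum.inr f) :
    MvPolynomial (Fin n × Fin m) ℂ) ∈ y.asIdeal ↔ f ∈ y.asIdeal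
  rw [aeval_rename, Sum.elim_comp_inr, aeval_X_left_apply]

theorem sectionX_matPoint (p : LUPair m n) (hp : p.Y = 0) :
    sectionX m n (matPoint p.X) = p.toPoint := by
  refine PrimeSpectrum.ext (Ideal.ext fun f => ?_)
  obtain ⟨f, rfl⟩ := Ideal.Quotient.mk_surjective f
  change eval _ (aeval (R := ℂ) (Sum.elim X fun _ => 0) f) = 0 ↔ p.evalAmbient f = 0
  rw [← aeval_eq_eval, ← AlgHom.comp_apply, comp_aeval, LUPair.evalAmbient,
    ← aeval_eq_eval]
  have : (fun i => aeval (fun ij : Fin m × Fin n => p.X ij.1 ij.2)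
      ((Sum.elim X fun _ => 0 : Vars m n → MvPolynomial (Fin m × Fin n) ℂ) i)) =
      Sum.elim (fun ij => p.X ij.1 ij.2) fun ji => p.Y ji.1 ji.2 := by
    funext i
    rcases i with i | i <;> simp [hp]
  rw [this]

theorem sectionY_matPoint (p : LUPair m n) (hp : p.X = 0) :
    sectionY m n (matPoint p.Y) = p.toPoint := by
  refine PrimeSpectrum.ext (Ideal.ext fun f => ?_)
  obtain ⟨f, rfl⟩ := Ideal.Quotient.mk_surjective f
  change eval _ (aeval (R := ℂ) (Sum.elim (fun _ => 0) X) f) = 0 ↔ p.evalAmbient f = 0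
  rw [← aeval_eq_eval, ← AlgHom.comp_apply, comp_aeval, LUPair.evalAmbient,
    ← aeval_eq_eval]
  have : (fun i => aeval (fun ij : Fin n × Fin m => p.Y ij.1 ij.2)
      ((Sum.elim (fun _ => 0) X : Vars m n → MvPolynomial (Fin n × Fin m) ℂ) i)) =
      Sum.elim (fun ij => p.X ij.1 ij.2) fun ji => p.Y ji.1 ji.2 := by
    funext i
    rcases i with i | i <;> simp [hp]
  rw [this]

/-- The orbit set contains the pairs `(b π c, 0)`, so the section `X ↦ (X, 0)` maps the matrix
Schubert variety into `E_π`. -/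
theorem projX_image_luComponent (hmn : m ≤ n) (π : Fin m ↪ Fin n) :
    projX m n '' luComponent π = matrixSchubert (permMat π) := by
  rw [luComponent_eq_closure_orbitSet hmn, matrixSchubert]
  apply Set.Subset.antisymm
  · refine (image_closure_subset_closure_image (projX m n).continuous).trans (closure_mono ?_)
    rintro _ ⟨_, ⟨_, ⟨b, c, s, rfl⟩, rfl⟩, rfl⟩
    exact ⟨b.1, b.2, _, (c⁻¹).2, projX_toPoint _⟩
  · intro x hx
    refine ⟨sectionX m n x, ?_, projX_sectionX x⟩
    refine closure_mono ?_
      (image_closure_subset_closure_image (sectionX m n).continuous ⟨x, hx, rfl⟩)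
    rintro _ ⟨_, ⟨b, hb, c, hc, rfl⟩, rfl⟩
    refine ⟨_, ⟨⟨b, hb⟩, ⟨c, hc⟩⁻¹, 0, rfl⟩, ?_⟩
    rw [← sectionX_matPoint]
    · simp [act, basePair]
    · simp [act, basePair]

/-- The set of matrices `c πᵀ b` whose closure is the image of `E_π` under `(X, Y) ↦ Y`. -/
def transposeOrbit (π : Fin m ↪ Fin n) : Set (matSpace n m) :=
  {y | ∃ (b : BMinus m) (c : BPlus n), y = matPoint (c.1.1 * (permMat π)ᵀ * b.1.1)}

theorem projY_image_luComponent (hmn : m ≤ n) (π : Fin m ↪ Fin n) :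
    projY m n '' luComponent π = closure (transposeOrbit π) := by
  apply Set.Subset.antisymm
  · refine (image_closure_subset_closure_image (projY m n).continuous).trans (closure_mono ?_)
    rintro _ ⟨_, ⟨p, hp, rfl⟩, rfl⟩
    -- on the generic locus `s` is invertible, so that `πᵀ s b⁻¹` lies in `πᵀ B₋`
    obtain ⟨b, c, s, rfl⟩ := genericSet_subset_orbitSet hmn π hp
    have hs : ∀ i, s i ≠ 0 := by
      intro i
      have := hp.2.2 i
      rw [act_X_mul_Y_diag] at this
      have e : ((basePair π s).X * (basePair π s).Y) i i = s i := by
        change (injMatrix ℂ π * ((injMatrix ℂ π)ᵀ * diagonal s)) i i = s i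
        rw [← Matrix.mul_assoc, injMatrix_mul_transpose, Matrix.one_mul, diagonal_apply_eq]
      rwa [e] at this
    obtain ⟨t, ht⟩ := BMinus.exists_coe_eq (diagonal s) (blockTriangular_diagonal _)
      (fun i => by simpa using hs i)
    refine ⟨t * b⁻¹, c, ?_⟩
    rw [projY_toPoint]
    congr 1
    simp only [act, basePair, Subgroup.coe_mul, Units.val_mul, ht, Matrix.mul_assoc]
  · intro y hy
    refine ⟨sectionY m n y, ?_, projY_sectionY y⟩
    have hsub : sectionY m n '' transposeOrbit π ⊆ luComponent π := by
      rintro _ ⟨_, ⟨b, c, rfl⟩, rfl⟩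
      -- `(0, Y)` is the limit of pairs `(t X, Y)` whose first entry lies in `B₋ π B₊` for `t ≠ 0`
      let q : ℂ → LUPair m n := fun t => act b⁻¹ c
        ⟨t • permMat π, (permMat π)ᵀ, by
          rw [Matrix.smul_mul, permMat_eq_injMatrix, injMatrix_mul_transpose,
            smul_one_eq_diagonal]
          exact blockTriangular_diagonal _, by
          have := (basePair π fun _ => t).upper
          simpa [basePair, ← smul_one_eq_diagonal] using this⟩
      have hq : c.1.1 * (permMat π)ᵀ * b.1.1 = (q 0).Y := by simp [q, act]
      rw [hq, sectionY_matPoint (q 0) (by simp [q, act])]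
      refine toPoint_mem_closure_of_line q 0 ((b⁻¹ : BMinus m).1.1 * permMat π *
        (c⁻¹ : BPlus n).1.1) (c.1.1 * (permMat π)ᵀ * b.1.1) 0 (fun t => by simp [q, act])
        (fun t => by simp [q, act]) (Set.finite_singleton 0) fun t ht => ?_
      obtain ⟨d, hd⟩ := BMinus.exists_coe_eq (diagonal fun _ : Fin m => t)
        (blockTriangular_diagonal _) (fun i => by simpa using ht)
      refine toPoint_mem_luComponent (q t) (b⁻¹ * d) c⁻¹ ?_
      simp only [q, act, Subgroup.coe_mul, Units.val_mul, hd, ← smul_one_eq_diagonal,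
        Matrix.mul_smul, Matrix.smul_mul, Matrix.mul_one, Matrix.mul_assoc]
    exact closure_minimal hsub isClosed_closure
      (image_closure_subset_closure_image (sectionY m n).continuous ⟨y, hy, rfl⟩)

theorem longest_mul_longest (k : ℕ) : longest k * longest k = 1 := by
  ext i j
  simp only [longest, Matrix.mul_apply, Matrix.one_apply, Matrix.of_apply, ite_mul, one_mul,
    zero_mul, Finset.sum_ite_eq, Finset.mem_univ, if_true, Fin.rev_rev]

theorem longest_conj_apply {k : ℕ} (A : Matrix (Fin k) (Fin k) ℂ) (i j : Fin k) :
    (longest k * A * longest k) i j = A (Fin.rev i) (Fin.rev j) := by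
  have h : ∀ l, (if Fin.rev l = j then (1 : ℂ) else 0) = if l = Fin.rev j then 1 else 0 := by
    intro l
    simp [Fin.rev_eq_iff]
  simp [longest, Matrix.mul_apply, h]

theorem exists_BPlus_longest_conj {k : ℕ} (b : BMinus k) :
    ∃ c : BPlus k, c.1.1 = longest k * b.1.1 * longest k :=
  BPlus.exists_coe_eq _ (fun i j hij => by
      rw [longest_conj_apply]
      exact b.2 (i := Fin.rev i) (j := Fin.rev j) (Fin.rev_lt_rev.mpr hij))
    fun i => by
      rw [longest_conj_apply]
      exact BMinus.diag_ne_zero b _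

theorem exists_BMinus_longest_conj {k : ℕ} (c : BPlus k) :
    ∃ b : BMinus k, b.1.1 = longest k * c.1.1 * longest k := by
  refine BMinus.exists_coe_eq _ (fun i j hij => ?_) fun i => ?_
  · rw [longest_conj_apply]
    exact c.2 (i := Fin.rev i) (j := Fin.rev j) (Fin.rev_lt_rev.mpr hij)
  · rw [longest_conj_apply]
    intro h
    have := upper_mul_diag c.2 (c⁻¹).2 (Fin.rev i)
    rw [BPlus.mul_inv, h, zero_mul, one_apply_eq] at this
    exact one_ne_zero this

theorem mulMulMap_matPoint {p q : ℕ} (P : Matrix (Fin p) (Fin p) ℂ) (Q : Matrix (Fin q) (Fin q) ℂ)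
    (M : Matrix (Fin p) (Fin q) ℂ) : mulMulMap P Q (matPoint M) = matPoint (P * M * Q) := by
  refine PrimeSpectrum.ext (Ideal.ext fun f => ?_)
  change eval _ (bind₁ (fun ij : Fin p × Fin q => genericMulMul P Q ij.1 ij.2) f) = 0 ↔
    eval _ f = 0
  rw [← aeval_eq_eval, aeval_bind₁, ← aeval_eq_eval]
  have : (fun ij : Fin p × Fin q => aeval (fun ij : Fin p × Fin q => M ij.1 ij.2)
      (genericMulMul P Q ij.1 ij.2)) = fun ij => (P * M * Q) ij.1 ij.2 := by
    funext ij
    simp [genericMulMul, Matrix.mul_apply]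
  rw [this]

theorem mulMulMap_mulMulMap {p q : ℕ} {P : Matrix (Fin p) (Fin p) ℂ} {Q : Matrix (Fin q) (Fin q) ℂ}
    (hP : P * P = 1) (hQ : Q * Q = 1) (x : matSpace p q) :
    mulMulMap P Q (mulMulMap P Q x) = x := by
  change PrimeSpectrum (MvPolynomial (Fin p × Fin q) ℂ) at x
  refine PrimeSpectrum.ext (Ideal.ext fun f => ?_)
  change bind₁ (fun ij : Fin p × Fin q => genericMulMul P Q ij.1 ij.2)
    (bind₁ (fun ij : Fin p × Fin q => genericMulMul P Q ij.1 ij.2) f) ∈ x.asIdeal ↔ f ∈ x.asIdeal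
  rw [bind₁_bind₁]
  set φ := (bind₁ fun ij : Fin p × Fin q => genericMulMul P Q ij.1 ij.2) with hφ
  have hX : (mvPolynomialX (Fin p) (Fin q) ℂ).map φ = genericMulMul P Q := by
    ext1 i j
    simp [hφ]
  have hC : ∀ {k : ℕ} (A : Matrix (Fin k) (Fin k) ℂ),
      (A.map (C : ℂ →+* MvPolynomial (Fin p × Fin q) ℂ)).map φ = A.map C := by
    intro k A
    ext1 i j
    simp [hφ]
  have h : (genericMulMul P Q).map φ = mvPolynomialX (Fin p) (Fin q) ℂ := by
    conv_lhs => rw [genericMulMul]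
    rw [Matrix.map_mul, Matrix.map_mul, hC, hC, hX, genericMulMul]
    set P' := P.map (C : ℂ →+* MvPolynomial (Fin p × Fin q) ℂ) with hP'
    set Q' := Q.map (C : ℂ →+* MvPolynomial (Fin p × Fin q) ℂ) with hQ'
    have hPP : P' * P' = 1 := by
      rw [hP', ← Matrix.map_mul, hP, Matrix.map_one _ (map_zero _) (map_one _)]
    have hQQ : Q' * Q' = 1 := by
      rw [hQ', ← Matrix.map_mul, hQ, Matrix.map_one _ (map_zero _) (map_one _)]
    calc P' * (P' * mvPolynomialX (Fin p) (Fin q) ℂ * Q') * Q'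
        = (P' * P') * mvPolynomialX (Fin p) (Fin q) ℂ * (Q' * Q') := by
          simp only [Matrix.mul_assoc]
      _ = _ := by rw [hPP, hQQ, Matrix.one_mul, Matrix.mul_one]
  have h' : (fun ij : Fin p × Fin q => φ (genericMulMul P Q ij.1 ij.2)) = X := by
    funext ij
    exact congrFun (congrFun h ij.1) ij.2
  rw [h']
  simp

theorem mulMulMap_image_matrixSchubert (π : Fin m ↪ Fin n) :
    mulMulMap (longest n) (longest m) ''
      matrixSchubert (longest n * (permMat π)ᵀ * longest m) = closure (transposeOrbit π) := by
  set f := mulMulMap (longest n) (longest m)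
  have hff : ∀ x, f (f x) = x :=
    mulMulMap_mulMulMap (longest_mul_longest n) (longest_mul_longest m)
  have hcl : ∀ S : Set (matSpace n m), f '' closure S = closure (f '' S) := by
    intro S
    refine (image_closure_subset_closure_image f.continuous).antisymm fun x hx => ?_
    refine ⟨f x, ?_, hff x⟩
    refine closure_mono ?_ (image_closure_subset_closure_image f.continuous ⟨x, hx, rfl⟩)
    rintro _ ⟨_, ⟨y, hy, rfl⟩, rfl⟩
    rwa [hff]
  rw [matrixSchubert, hcl]
  congr 1
  have hassoc : ∀ (b : Matrix (Fin n) (Fin n) ℂ) (c : Matrix (Fin m) (Fin m) ℂ),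
      longest n * (b * (longest n * (permMat π)ᵀ * longest m) * c) * longest m =
        (longest n * b * longest n) * (permMat π)ᵀ * (longest m * c * longest m) := by
    intro b c
    simp only [Matrix.mul_assoc]
  apply Set.Subset.antisymm
  · rintro _ ⟨_, ⟨b, hb, c, hc, rfl⟩, rfl⟩
    obtain ⟨b', hb'⟩ := exists_BPlus_longest_conj ⟨b, hb⟩
    obtain ⟨c', hc'⟩ := exists_BMinus_longest_conj ⟨c, hc⟩
    refine ⟨c', b', ?_⟩
    rw [mulMulMap_matPoint, hassoc, hb', hc']
  · rintro _ ⟨b, c, rfl⟩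
    obtain ⟨b', hb'⟩ := exists_BPlus_longest_conj b
    obtain ⟨c', hc'⟩ := exists_BMinus_longest_conj c
    refine ⟨_, ⟨c'.1, c'.2, b'.1, b'.2, rfl⟩, ?_⟩
    have hinv : ∀ {k : ℕ} (A : Matrix (Fin k) (Fin k) ℂ),
        longest k * (longest k * A * longest k) * longest k = A := by
      intro k A
      calc _ = (longest k * longest k) * A * (longest k * longest k) := by
            simp only [Matrix.mul_assoc]
        _ = A := by rw [longest_mul_longest, Matrix.one_mul, Matrix.mul_one]
    rw [mulMulMap_matPoint, hassoc, hb', hc', hinv, hinv]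

end Projections

/-! ### A birational parametrization of `E_π` -/

section Param

variable {m n : ℕ} {R : Type*} [CommRing R] {π : Fin m ↪ Fin n}

/-- The coordinates of the affine space parametrizing `E_π`: the entries `(i, k)` with `k ≤ i` of a
lower triangular matrix and the pairs `(i, j)` with `j ≠ π i'` for all `i' < i`. -/
abbrev ParamIdx (π : Fin m ↪ Fin n) : Type :=
  {ik : Fin m × Fin m // ik.2 ≤ ik.1} ⊕ {ij : Fin m × Fin n // ∀ i' < ij.1, π i' ≠ ij.2}

theorem card_paramIdx (π : Fin m ↪ Fin n) : Fintype.card (ParamIdx π) = m * (n + 1) := by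
  classical
  have h1 : ∀ i : Fin m, Fintype.card {k : Fin m // k ≤ i} = i + 1 := fun i => by
    rw [Fintype.card_subtype, ← Fin.card_Iic i]
    congr 1
    ext k
    simp
  have h2 : ∀ i : Fin m, Fintype.card {j : Fin n // ∀ i' < i, π i' ≠ j} = n - i := fun i => by
    have h := Finset.card_compl ((Finset.Iio i).map π)
    rw [Finset.card_map, Fin.card_Iio, Fintype.card_fin] at h
    rw [Fintype.card_subtype, ← h]
    congr 1
    ext j
    simp
  have e1 : {ik : Fin m × Fin m // ik.2 ≤ ik.1} ≃ Σ i : Fin m, {k : Fin m // k ≤ i} :=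
    ⟨fun x => ⟨x.1.1, x.1.2, x.2⟩, fun x => ⟨(x.1, x.2.1), x.2.2⟩, fun _ => rfl, fun _ => rfl⟩
  have e2 : {ij : Fin m × Fin n // ∀ i' < ij.1, π i' ≠ ij.2} ≃
      Σ i : Fin m, {j : Fin n // ∀ i' < i, π i' ≠ j} :=
    ⟨fun x => ⟨x.1.1, x.1.2, x.2⟩, fun x => ⟨(x.1, x.2.1), x.2.2⟩, fun _ => rfl, fun _ => rfl⟩
  have hmn : m ≤ n := by simpa using Fintype.card_le_of_embedding π
  rw [Fintype.card_sum, Fintype.card_congr e1, Fintype.card_congr e2, Fintype.card_sigma,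
    Fintype.card_sigma, ← Finset.sum_add_distrib, Finset.sum_congr rfl fun i _ => by
      rw [h1, h2, show (i : ℕ) + 1 + (n - i) = n + 1 by omega]]
  simp

/-- The lower triangular factor `b`. -/
def paramB (a : ParamIdx π → R) : Matrix (Fin m) (Fin m) R :=
  Matrix.of fun i k => if h : k ≤ i then a (Sum.inl ⟨(i, k), h⟩) else 0

/-- The strictly upper triangular part of the normal form `π + N` of the matrices in `π B₊`. -/
def paramN (a : ParamIdx π → R) : Matrix (Fin m) (Fin n) R :=
  Matrix.of fun i j =>
    if h : (∀ i' < i, π i' ≠ j) ∧ π i < j then a (Sum.inr ⟨(i, j), h.1⟩) else 0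

/-- The general matrix `V` for which `(π, V)` lies in `E`. -/
def paramV (a : ParamIdx π → R) : Matrix (Fin n) (Fin m) R :=
  Matrix.of fun j i =>
    if h : (∀ i' < i, π i' ≠ j) ∧ j ≤ π i then a (Sum.inr ⟨(i, j), h.1⟩) else 0

/-- The upper triangular factor `c`. -/
def paramC (a : ParamIdx π → R) : Matrix (Fin n) (Fin n) R := unipotent π (paramN a)

/-- The matrix `X = b π c`. -/
def paramX (a : ParamIdx π → R) : Matrix (Fin m) (Fin n) R :=
  paramB a * (injMatrix R π * paramC a)

/-- The matrix `Y`, up to the factor `det b` equal to `c⁻¹ V b⁻¹`; the adjugates make it polynomial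
in the parameters. -/
def paramY (a : ParamIdx π → R) : Matrix (Fin n) (Fin m) R :=
  (paramC a).adjugate * paramV a * (paramB a).adjugate

theorem paramB_lower (a : ParamIdx π → R) : (paramB a).IsLowerTriangular := by
  intro i j hij
  have hij' : i < j := hij
  simp [paramB, hij'.not_ge]

theorem paramN_eq_zero (a : ParamIdx π → R) (i : Fin m) (j : Fin n) (h : j ≤ π i) :
    paramN a i j = 0 := by
  simp [paramN, h.not_gt]

theorem paramN_apply_of_lt (a : ParamIdx π → R) {i i' : Fin m} (h : i' < i) :
    paramN a i (π i') = 0 :=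
  dif_neg fun h' => h'.1 i' h rfl

theorem det_paramC (a : ParamIdx π → R) : (paramC a).det = 1 := det_unipotent (paramN_eq_zero a)

theorem paramC_mul_adjugate (a : ParamIdx π → R) : paramC a * (paramC a).adjugate = 1 := by
  rw [mul_adjugate, det_paramC, one_smul]

theorem injMatrix_mul_paramV_lower (a : ParamIdx π → R) :
    (injMatrix R π * paramV a).IsLowerTriangular := by
  intro i k hik
  rw [injMatrix_mul_apply]
  exact dif_neg fun h => h.1 i hik rfl

theorem paramV_mul_injMatrix_upper (a : ParamIdx π → R) :
    (paramV a * injMatrix R π).IsUpperTriangular := by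
  intro j j' hj
  have hj' : j' < j := hj
  by_cases h : ∃ k, π k = j'
  · obtain ⟨k, rfl⟩ := h
    rw [mul_injMatrix_apply]
    exact dif_neg fun h => hj'.not_ge h.2
  · push Not at h
    exact mul_injMatrix_apply_of_notMem π _ _ h

section Map

variable {S : Type*} [CommRing S] (f : R →+* S) (a : ParamIdx π → R)

theorem paramB_map : (paramB a).map f = paramB (f ∘ a) := by
  ext i k
  simp only [paramB, Matrix.map_apply, Matrix.of_apply, Function.comp_apply]
  split_ifs <;> simp

theorem paramN_map : (paramN a).map f = paramN (f ∘ a) := by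
  ext i k
  simp only [paramN, Matrix.map_apply, Matrix.of_apply, Function.comp_apply]
  split_ifs <;> simp

theorem paramV_map : (paramV a).map f = paramV (f ∘ a) := by
  ext i k
  simp only [paramV, Matrix.map_apply, Matrix.of_apply, Function.comp_apply]
  split_ifs <;> simp

theorem injMatrix_map (π : Fin m ↪ Fin n) : (injMatrix R π).map f = injMatrix S π := by
  ext i k
  simp only [injMatrix, Matrix.map_apply, Matrix.of_apply]
  split_ifs <;> simp

theorem paramC_map : (paramC a).map f = paramC (f ∘ a) := by
  rw [paramC, paramC, unipotent, unipotent, ← paramN_map, Matrix.map_add _ (map_add f),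
    Matrix.map_mul, Matrix.transpose_map, injMatrix_map, Matrix.map_one _ (map_zero f) (map_one f)]

theorem paramX_map : (paramX a).map f = paramX (f ∘ a) := by
  rw [paramX, paramX, ← paramB_map, ← paramC_map, Matrix.map_mul, Matrix.map_mul, injMatrix_map]

theorem paramY_map : (paramY a).map f = paramY (f ∘ a) := by
  have hadj : ∀ {k : ℕ} (A : Matrix (Fin k) (Fin k) R), A.adjugate.map f = (A.map f).adjugate :=
    fun A => RingHom.map_adjugate f A
  rw [paramY, paramY, ← paramB_map, ← paramC_map, ← paramV_map, Matrix.map_mul, Matrix.map_mul,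
    hadj, hadj]

end Map

theorem BMinus.adjugate_eq {k : ℕ} (b : BMinus k) :
    b.1.1.adjugate = b.1.1.det • (b⁻¹ : BMinus k).1.1 := by
  calc b.1.1.adjugate = b.1.1.adjugate * (b.1.1 * (b⁻¹ : BMinus k).1.1) := by
        rw [BMinus.mul_inv, Matrix.mul_one]
    _ = _ := by rw [← Matrix.mul_assoc, adjugate_mul, Matrix.smul_mul, Matrix.one_mul]

theorem adjugate_unipotent {N : Matrix (Fin m) (Fin n) ℂ} (hN : ∀ i j, j ≤ π i → N i j = 0)
    (c : BPlus n) (hc : c.1.1 = unipotent π N) :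
    (unipotent π N).adjugate = (c⁻¹ : BPlus n).1.1 := by
  calc (unipotent π N).adjugate
      = (unipotent π N).adjugate * (c.1.1 * (c⁻¹ : BPlus n).1.1) := by
        rw [BPlus.mul_inv, Matrix.mul_one]
    _ = _ := by rw [← Matrix.mul_assoc, hc, adjugate_mul, det_unipotent hN, one_smul,
      Matrix.one_mul]

/-- The parametrization takes values in `E_π`. -/
theorem exists_toPoint_mem_luComponent (a : ParamIdx π → ℂ) (ha : (paramB a).det ≠ 0) :
    ∃ p : LUPair m n, p.X = paramX a ∧ p.Y = paramY a ∧ p.toPoint ∈ luComponent π := by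
  obtain ⟨b, hb⟩ := BMinus.exists_coe_eq (paramB a) (paramB_lower a) (by
    rw [det_of_isLowerTriangular _ (paramB_lower a)] at ha
    exact fun i => Finset.prod_ne_zero_iff.mp ha i (Finset.mem_univ i))
  obtain ⟨c, hc⟩ := BPlus.exists_coe_eq (paramC a) (unipotent_upper (paramN_eq_zero a))
    fun i => by
      rw [paramC, unipotent_diag (paramN_eq_zero a)]
      exact one_ne_zero
  let q : LUPair m n := ⟨permMat π, (paramB a).det • paramV a, by
    rw [Matrix.mul_smul]
    exact fun i j hij => by
      rw [Matrix.smul_apply, permMat_eq_injMatrix, injMatrix_mul_paramV_lower a hij, smul_zero], by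
    rw [Matrix.smul_mul]
    exact fun i j hij => by
      rw [Matrix.smul_apply, permMat_eq_injMatrix, paramV_mul_injMatrix_upper a hij, smul_zero]⟩
  refine ⟨act b c⁻¹ q, ?_, ?_, act_toPoint_mem_luComponent π b c⁻¹ q rfl⟩
  · simp only [act, q, hb, hc, inv_inv, paramX, permMat_eq_injMatrix, Matrix.mul_assoc]
  · rw [paramY, ← hb, BMinus.adjugate_eq, paramC, adjugate_unipotent (paramN_eq_zero a) c hc]
    simp only [act, q, hb, Matrix.mul_smul, Matrix.smul_mul]

/-- The parametrization reaches every generic pair of `E_π`. -/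
theorem exists_param_of_mem_genericSet {p : LUPair m n} (hp : p ∈ genericSet π) :
    ∃ a : ParamIdx π → ℂ, p.X = paramX a ∧ p.Y = paramY a := by
  have hmn : m ≤ n := by simpa using Fintype.card_le_of_embedding π
  have hdet : IsUnit (p.X * p.Y).det := by
    rw [isUnit_iff_ne_zero, det_of_isLowerTriangular _ p.lower]
    exact Finset.prod_ne_zero_iff.mpr fun i _ => hp.2.2 i
  obtain ⟨b, ρ, N, hN, hN', hX⟩ := exists_bruhat_of_mul_eq_one hmn p.X (p.Y * (p.X * p.Y)⁻¹)
    (by rw [← Matrix.mul_assoc, mul_nonsing_inv _ hdet])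
  obtain ⟨c, hc⟩ := BPlus.exists_coe_eq (unipotent ρ N) (unipotent_upper hN)
    fun i => by simp [unipotent_diag hN]
  -- the diagonals of `XY` and `YX` show that the Bruhat cell of `X` is that of `π`
  obtain rfl : π = ρ := eq_of_mem_genericSet hmn hp
    (diag_eq_of_toPoint_mem_luComponent (toPoint_mem_luComponent p b c (by rw [hX, hc]; rfl)))
  set q := act b⁻¹ c p with hq
  have hpq : p = act b c⁻¹ q := by
    rw [hq, act_act, mul_inv_cancel, inv_mul_cancel, act_one]
  have hqX : q.X = injMatrix ℂ π := by
    calc (b⁻¹ : BMinus m).1.1 * p.X * (c⁻¹ : BPlus n).1.1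
        = ((b⁻¹ : BMinus m).1.1 * b.1.1) * injMatrix ℂ π * (c.1.1 * (c⁻¹ : BPlus n).1.1) := by
          rw [hX, hc]; simp only [Matrix.mul_assoc]
      _ = _ := by rw [BMinus.inv_mul, BPlus.mul_inv, Matrix.one_mul, Matrix.mul_one]
  have hl := q.lower
  have hu := q.upper
  rw [hqX] at hl hu
  have hdb := BMinus.det_ne_zero b
  let a : ParamIdx π → ℂ := Sum.elim (fun ik => b.1.1 ik.1.1 ik.1.2)
    fun ij => if π ij.1.1 < ij.1.2 then N ij.1.1 ij.1.2 else (b.1.1.det)⁻¹ * q.Y ij.1.2 ij.1.1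
  have haB : paramB a = b.1.1 := by
    ext i k
    by_cases h : k ≤ i
    · simp [paramB, h, a]
    · rw [b.2 (i := i) (j := k) (not_le.mp h)]
      simp [paramB, h]
  have haN : paramN a = N := by
    ext i j
    by_cases h : (∀ i' < i, π i' ≠ j) ∧ π i < j
    · simp only [paramN, Matrix.of_apply, dif_pos h, a, Sum.elim_inr, if_pos h.2]
    · simp only [paramN, Matrix.of_apply, dif_neg h]
      by_cases h1 : π i < j
      · have : ∃ i' < i, π i' = j := by
          by_contra h2
          push Not at h2
          exact h ⟨h2, h1⟩
        obtain ⟨i', hi', rfl⟩ := this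
        exact (hN' i i' hi').symm
      · exact (hN i j (not_lt.mp h1)).symm
  have haV : paramV a = (b.1.1.det)⁻¹ • q.Y := by
    ext j i
    by_cases h : (∀ i' < i, π i' ≠ j) ∧ j ≤ π i
    · simp only [paramV, Matrix.of_apply, dif_pos h, a, Sum.elim_inr, if_neg h.2.not_gt,
        Matrix.smul_apply, smul_eq_mul]
    · simp only [paramV, Matrix.of_apply, dif_neg h, Matrix.smul_apply, smul_eq_mul]
      have h0 : q.Y j i = 0 := by
        by_cases h1 : j ≤ π i
        · have : ∃ i' < i, π i' = j := by
            by_contra h2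
            push Not at h2
            exact h ⟨h2, h1⟩
          obtain ⟨i', hi', rfl⟩ := this
          exact (injMatrix_mul_apply π q.Y i' i).symm.trans (hl hi')
        · exact (mul_injMatrix_apply π q.Y j i).symm.trans
            (hu (i := j) (j := π i) (not_le.mp h1))
      rw [h0, mul_zero]
  refine ⟨a, ?_, ?_⟩
  · rw [paramX, paramC, haB, haN, hX]
  · rw [paramY, paramC, haB, haN, haV, BMinus.adjugate_eq, adjugate_unipotent hN c hc]
    conv_lhs => rw [hpq]
    simp [act, hdb]

/-- The parameters are rational functions of the entries of `X` and `Y`: the matrices `b` and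
`π + N` are computed row by row, as in the `LU` decomposition. -/
theorem param_mem_of_entries_mem {K : Type*} [Field K] {F : Type*} [SetLike F K] [SubfieldClass F K]
    (s : F) (a : ParamIdx π → K) (hb : ∀ i, paramB a i i ≠ 0)
    (hX : ∀ i j, paramX a i j ∈ s) (hY : ∀ j i, paramY a j i ∈ s) (x : ParamIdx π) : a x ∈ s := by
  have hrows : ∀ i, (∀ k, paramB a i k ∈ s) ∧ ∀ j, paramN a i j ∈ s := by
    intro i
    induction i using WellFoundedLT.induction with
    | ind i ih =>
    have hXe : ∀ j, paramX a i j = ∑ l, paramB a i l * (injMatrix K π + paramN a) l j := fun j => by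
      rw [paramX, paramC, injMatrix_mul_unipotent, Matrix.mul_apply]
    have hinj : ∀ l j, injMatrix K π l j ∈ s := fun l j => by
      simp only [injMatrix, Matrix.of_apply]
      split_ifs
      exacts [one_mem s, zero_mem s]
    have hB : ∀ k, paramB a i k ∈ s := by
      intro k
      induction k using WellFoundedLT.induction with
      | ind k ihk =>
      by_cases hki : k ≤ i
      · have h := hXe (π k)
        rw [← Finset.add_sum_erase _ _ (Finset.mem_univ k), Matrix.add_apply,
          paramN_eq_zero a k _ le_rfl, add_zero,
          show injMatrix K π k (π k) = 1 by simp [injMatrix], mul_one] at h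
        rw [eq_sub_of_add_eq h.symm]
        refine sub_mem (hX _ _) (sum_mem fun l hl => ?_)
        rcases lt_or_gt_of_ne (Finset.ne_of_mem_erase hl) with h1 | h1
        · exact mul_mem (ihk l h1) (add_mem (hinj _ _) ((ih l (h1.trans_le hki)).2 _))
        · rw [Matrix.add_apply, paramN_apply_of_lt a h1,
            show injMatrix K π l (π k) = 0 by simp [injMatrix, h1.ne']]
          simp [zero_mem]
      · rw [paramB_lower a (i := i) (j := k) (not_le.mp hki)]
        exact zero_mem s
    refine ⟨hB, fun j => ?_⟩
    have h := hXe j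
    rw [← Finset.add_sum_erase _ _ (Finset.mem_univ i)] at h
    have h' : paramN a i j = (paramB a i i)⁻¹ * (paramX a i j -
        ∑ l ∈ Finset.univ.erase i, paramB a i l * (injMatrix K π + paramN a) l j) -
          injMatrix K π i j := by
      rw [h, add_sub_cancel_right, inv_mul_cancel_left₀ (hb i), Matrix.add_apply,
        add_sub_cancel_left]
    rw [h']
    refine sub_mem (mul_mem (inv_mem (hB i)) (sub_mem (hX _ _) (sum_mem fun l hl => ?_))) (hinj _ _)
    rcases lt_or_gt_of_ne (Finset.ne_of_mem_erase hl) with h1 | h1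
    · exact mul_mem (hB l) (add_mem (hinj _ _) ((ih l h1).2 _))
    · rw [paramB_lower a (i := i) (j := l) h1, zero_mul]
      exact zero_mem s
  have hdet : (paramB a).det ∈ s := by
    rw [det_of_isLowerTriangular _ (paramB_lower a)]
    exact prod_mem fun i _ => (hrows i).1 i
  have hdet0 : (paramB a).det ≠ 0 := by
    rw [det_of_isLowerTriangular _ (paramB_lower a)]
    exact Finset.prod_ne_zero_iff.mpr fun i _ => hb i
  have hC : ∀ j j', paramC a j j' ∈ s := by
    intro j j'
    rw [paramC, unipotent, Matrix.add_apply]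
    refine add_mem ?_ ?_
    · rw [Matrix.one_apply]
      split_ifs
      exacts [one_mem s, zero_mem s]
    · by_cases h : ∃ k, π k = j
      · obtain ⟨k, rfl⟩ := h
        rw [injMatrix_transpose_mul_apply]
        exact (hrows k).2 j'
      · push Not at h
        rw [injMatrix_transpose_mul_apply_of_notMem π _ h]
        exact zero_mem s
  have hVe : paramC a * paramY a * paramB a = (paramB a).det • paramV a := by
    calc _ = (paramC a * (paramC a).adjugate) * paramV a * ((paramB a).adjugate * paramB a) := by
          simp only [paramY, Matrix.mul_assoc]
      _ = _ := by
          rw [paramC_mul_adjugate, adjugate_mul, Matrix.one_mul, Matrix.mul_smul, Matrix.mul_one]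
  have hV : ∀ j i, paramV a j i ∈ s := by
    intro j i
    have h : paramV a j i = (paramB a).det⁻¹ * (paramC a * paramY a * paramB a) j i := by
      rw [hVe, Matrix.smul_apply, smul_eq_mul, inv_mul_cancel_left₀ hdet0]
    rw [h]
    refine mul_mem (inv_mem hdet) ?_
    rw [Matrix.mul_apply]
    refine sum_mem fun k _ => mul_mem ?_ ((hrows k).1 i)
    rw [Matrix.mul_apply]
    exact sum_mem fun l _ => mul_mem (hC _ _) (hY _ _)
  rcases x with ⟨⟨i, k⟩, h⟩ | ⟨⟨i, j⟩, h⟩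
  · have := (hrows i).1 k
    rwa [paramB, Matrix.of_apply, dif_pos h] at this
  · by_cases hj : π i < j
    · have := (hrows i).2 j
      rwa [paramN, Matrix.of_apply, dif_pos ⟨h, hj⟩] at this
    · have := hV j i
      rwa [paramV, Matrix.of_apply, dif_pos ⟨h, not_lt.mp hj⟩] at this

end Param

/-! ### Irreducibility and dimension -/

section Dimension

variable {m n : ℕ} (π : Fin m ↪ Fin n)

/-- The comorphism of the parametrization of `E_π`. -/
def paramHom : MvPolynomial (Vars m n) ℂ →ₐ[ℂ] MvPolynomial (ParamIdx π) ℂ :=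
  aeval (Sum.elim (fun ij => paramX X ij.1 ij.2) fun ji => paramY X ji.1 ji.2)

theorem eval_paramHom (a : ParamIdx π → ℂ) (p : LUPair m n) (hX : p.X = paramX a)
    (hY : p.Y = paramY a) (f : MvPolynomial (Vars m n) ℂ) :
    eval a (paramHom π f) = p.evalAmbient f := by
  have ha : (eval a : MvPolynomial (ParamIdx π) ℂ →+* ℂ) ∘ X = a := by
    funext i
    simp
  have h1 : ∀ i j, eval a (paramX (X : ParamIdx π → _) i j) = p.X i j := fun i j => by
    rw [hX, ← ha, ← paramX_map, ha]; rfl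
  have h2 : ∀ j i, eval a (paramY (X : ParamIdx π → _) j i) = p.Y j i := fun i j => by
    rw [hY, ← ha, ← paramY_map, ha]; rfl
  rw [LUPair.evalAmbient, ← aeval_eq_eval, ← aeval_eq_eval, paramHom, ← AlgHom.comp_apply,
    comp_aeval]
  congr 2
  funext i
  rcases i with i | i
  · simpa [aeval_eq_eval] using h1 i.1 i.2
  · simpa [aeval_eq_eval] using h2 i.1 i.2

theorem det_paramB_X_ne_zero :
    (paramB (X : ParamIdx π → MvPolynomial (ParamIdx π) ℂ)).det ≠ 0 := by
  rw [det_of_isLowerTriangular _ (paramB_lower _)]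
  refine Finset.prod_ne_zero_iff.mpr fun i _ => ?_
  rw [paramB, Matrix.of_apply, dif_pos le_rfl]
  exact X_ne_zero _

/-- The kernel of the comorphism consists of the equations of `E_π`. -/
theorem paramHom_eq_zero_iff (f : MvPolynomial (Vars m n) ℂ) :
    paramHom π f = 0 ↔ ∀ q ∈ genericSet π, q.evalAmbient f = 0 := by
  constructor
  · intro h q hq
    obtain ⟨a, hX, hY⟩ := exists_param_of_mem_genericSet hq
    rw [← eval_paramHom π a q hX hY, h, map_zero]
  · intro h
    -- where `det b ≠ 0`, the value of the parametrization is a pair in `E_π`, and multiplying by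
    -- `det b` disposes of the other parameters
    refine (mul_eq_zero.mp ?_).resolve_left (det_paramB_X_ne_zero π)
    refine MvPolynomial.funext fun a => ?_
    rw [map_mul, map_zero]
    have hdet : eval a (paramB (X : ParamIdx π → MvPolynomial (ParamIdx π) ℂ)).det =
        (paramB a).det := by
      have ha : (eval a : MvPolynomial (ParamIdx π) ℂ →+* ℂ) ∘ X = a := by
        funext i
        simp
      rw [RingHom.map_det]
      conv_rhs => rw [← ha, ← paramB_map]
      rfl
    rw [hdet]
    by_cases ha : (paramB a).det = 0
    · rw [ha, zero_mul]
    · obtain ⟨p, hX, hY, hp⟩ := exists_toPoint_mem_luComponent a ha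
      rw [eval_paramHom π a p hX hY, toPoint_mem_closure_iff.mp hp f h, mul_zero]

/-- The restriction map from `E` to the image of the parametrization. -/
def paramQuot : luRing m n →+* (paramHom π).range :=
  Ideal.Quotient.lift (luIdeal m n) (paramHom π).rangeRestrict.toRingHom fun f hf =>
    Subtype.ext ((paramHom_eq_zero_iff π f).mpr fun q _ => q.evalAmbient_eq_zero f hf)

theorem paramQuot_surjective : Function.Surjective (paramQuot π) := by
  intro y
  obtain ⟨f, rfl⟩ := (paramHom π).rangeRestrict_surjective y
  exact ⟨Ideal.Quotient.mk _ f, rfl⟩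

/-- `E_π` is the zero locus of a prime ideal, with the image of the comorphism of the
parametrization as quotient ring. -/
theorem luComponent_eq_zeroLocus :
    luComponent π = PrimeSpectrum.zeroLocus (RingHom.ker (paramQuot π) : Set (luRing m n)) := by
  ext x
  refine (mem_closure_toPoint_iff (S := genericSet π)).trans ⟨fun h f hf => ?_, fun h f hf => ?_⟩
  · obtain ⟨f, rfl⟩ := Ideal.Quotient.mk_surjective f
    exact h f ((paramHom_eq_zero_iff π f).mp (congrArg Subtype.val hf))
  · exact h (Subtype.ext ((paramHom_eq_zero_iff π f).mpr hf))

theorem isIrreducible_luComponent : IsIrreducible (luComponent π) := by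
  rw [luComponent_eq_zeroLocus]
  have := RingHom.ker_isPrime (paramQuot π)
  exact (PrimeSpectrum.isIrreducible_zeroLocus_iff_of_radical _ this.isRadical).mpr this

theorem topologicalKrullDim_luComponent :
    topologicalKrullDim (luComponent π) = ((m * (n + 1) : ℕ) : WithBot ℕ∞) := by
  rw [luComponent_eq_zeroLocus]
  refine (topologicalKrullDim_zeroLocus_ker (paramQuot π) (paramQuot_surjective π)).trans ?_
  rw [← card_paramIdx π]
  refine ringKrullDim_range_eq_card (paramHom π) fun x => ?_
  set K := FractionRing (MvPolynomial (ParamIdx π) ℂ)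
  set f := algebraMap (MvPolynomial (ParamIdx π) ℂ) K
  refine param_mem_of_entries_mem _ (f ∘ X) (fun i => ?_) (fun i j => ?_) (fun j i => ?_) x
  · rw [← paramB_map, Matrix.map_apply, paramB, Matrix.of_apply, dif_pos le_rfl]
    exact (map_ne_zero_iff f (IsFractionRing.injective _ _)).mpr (X_ne_zero _)
  · rw [← paramX_map, Matrix.map_apply]
    refine IntermediateField.subset_adjoin _ _ ⟨Sum.inl (i, j), ?_⟩
    simp [paramHom, f]
  · rw [← paramY_map, Matrix.map_apply]
    refine IntermediateField.subset_adjoin _ _ ⟨Sum.inr (j, i), ?_⟩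
    simp [paramHom, f]

end Dimension

theorem irreducibleComponents_luScheme {m n : ℕ} (hmn : m ≤ n) :
    irreducibleComponents (luScheme m n) = Set.range (luComponent (m := m) (n := n)) := by
  have hmax : ∀ s : Set (luScheme m n), IsIrreducible s →
      ∃ π : Fin m ↪ Fin n, s ⊆ luComponent π := by
    intro s hs
    have hcover : s ⊆ ⋃₀ Set.range (luComponent (m := m) (n := n)) := by
      rw [Set.sUnion_range, iUnion_luComponent hmn]
      exact Set.subset_univ s
    obtain ⟨z, hz, hsz⟩ := isIrreducible_iff_sUnion_isClosed.mp hs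
      (Set.finite_range (luComponent (m := m) (n := n))).toFinset (fun z hz => by
        obtain ⟨π, rfl⟩ := (Set.Finite.mem_toFinset _).mp hz
        exact isClosed_closure) (by rwa [Set.Finite.coe_toFinset])
    obtain ⟨π, rfl⟩ := (Set.Finite.mem_toFinset _).mp hz
    exact ⟨π, hsz⟩
  ext s
  constructor
  · intro hs
    obtain ⟨π, hπ⟩ := hmax s hs.1
    exact ⟨π, (hs.2 (isIrreducible_luComponent π) hπ).antisymm hπ⟩
  · rintro ⟨π, rfl⟩
    refine ⟨isIrreducible_luComponent π, fun t ht hπt => ?_⟩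
    obtain ⟨ρ, hρ⟩ := hmax t ht
    rwa [eq_of_luComponent_subset hmn (hπt.trans hρ)]

end LowerUpper

end

theorem mainTheorem7 (m n : ℕ) (hmn : m ≤ n) :
    -- the irreducible components of `E` are the `E_π`, for distinct `π` distinct
    irreducibleComponents (LowerUpper.luScheme m n) =
        Set.range (LowerUpper.luComponent (m := m) (n := n)) ∧
    Function.Injective (LowerUpper.luComponent (m := m) (n := n)) ∧
    ∀ π : Fin m ↪ Fin n,
      -- they are all of the top dimension
      topologicalKrullDim (LowerUpper.luComponent π) = ((m * (n + 1) : ℕ) : WithBot ℕ∞) ∧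
      -- the second description of `E_π`
      LowerUpper.luComponent π =
        closure (LowerUpper.LUPair.toPoint '' LowerUpper.orbitSet π) ∧
      -- the two projections of `E_π`
      LowerUpper.projX m n '' LowerUpper.luComponent π =
        LowerUpper.matrixSchubert (LowerUpper.permMat π) ∧
      LowerUpper.projY m n '' LowerUpper.luComponent π =
        LowerUpper.mulMulMap (LowerUpper.longest n) (LowerUpper.longest m) ''
          LowerUpper.matrixSchubert
            (LowerUpper.longest n * (LowerUpper.permMat π).transpose * LowerUpper.longest m) := by
  refine ⟨LowerUpper.irreducibleComponents_luScheme hmn, fun π ρ h =>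
    LowerUpper.eq_of_luComponent_subset hmn h.subset, fun π =>
    ⟨LowerUpper.topologicalKrullDim_luComponent π,
      LowerUpper.luComponent_eq_closure_orbitSet hmn π,
      LowerUpper.projX_image_luComponent hmn π, ?_⟩⟩
  rw [LowerUpper.projY_image_luComponent hmn, LowerUpper.mulMulMap_image_matrixSchubert]
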